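/- In a finite graph $G$, start with weight $1$ on every vertex. A \emph{unit acquisition move} transfers one unit of weight from a vertex $u$ of positive weight to a neighbour $v$ whose weight before the move is at least the weight of $u$. The \emph{unit acquisition number} $a_u(G)$ is the minimum number of vertices with positive weight in a configuration reachable by a finite sequence of such moves. A \emph{leaf} is a vertex of degree $1$, and $d'(v)$ denotes the number of leaf neighbours of $v$. A \emph{caterpillar} is a finite tree in which all non-leaf vertices lie on one path; the path obtained by deleting all its leaves is its \emph{spine}. \textbf{Theorem.} Let $T$ be a caterpillar with spine vertices $v_0,v_1,\dots,v_k,v_{k+1}$ in order; $v_1,\dots,v_k$ are the internal vertices of the spine (there are none if the spine has at most two vertices). Then $a_u(T)=1$ if and only if for every $1\le s\le k$, every set $S$ of $s$ consecutive internal spine vertices satisfies $$\sum_{v\in S} d'(v)\;\ge\;\ell(s):=\left\lceil\frac{s+1}{2}\right\rceil\left\lfloor\frac{s+1}{2}\right\rfloor .$$ The degenerate caterpillars, whose spine has only one vertex or is empty, are included; for them the condition is vacuous. -/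

import Mathlib

/-- One unit acquisition move on `G`: one unit of weight passes from a vertex `u` of positive weight
to a neighbour `v` whose weight before the move is at least that of `u`. -/
def UnitAcqMove {V : Type*} [DecidableEq V] (G : SimpleGraph V) (w w' : V → ℕ) : Prop :=
  ∃ u v : V, G.Adj u v ∧ 0 < w u ∧ w u ≤ w v ∧
    w' = Function.update (Function.update w u (w u - 1)) v (w v + 1)

/-- The weight functions reachable by successive unit acquisition moves from the
configuration in which every vertex has weight `1`. -/
def UnitAcqReachable {V : Type*} [DecidableEq V] (G : SimpleGraph V) (w : V → ℕ) : Prop :=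
  Relation.ReflTransGen (UnitAcqMove G) (fun _ => 1) w

/-- The unit acquisition number: the least number of vertices of positive weight in a reachable
configuration. (The set is nonempty: it contains the number of vertices.) -/
noncomputable def unitAcqNumber {V : Type*} [Fintype V] [DecidableEq V] (G : SimpleGraph V) : ℕ :=
  sInf {m : ℕ | ∃ w : V → ℕ, UnitAcqReachable G w ∧
    (Finset.univ.filter (fun v => 0 < w v)).card = m}

/-- A leaf is a vertex of degree one. -/
def IsLeafVertex {V : Type*} [Fintype V] (G : SimpleGraph V) [DecidableRel G.Adj] (v : V) : Prop :=
  G.degree v = 1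

instance {V : Type*} [Fintype V] (G : SimpleGraph V) [DecidableRel G.Adj] :
    DecidablePred (IsLeafVertex G) :=
  fun v => inferInstanceAs (Decidable (G.degree v = 1))

/-- A caterpillar is a tree in which all non-leaf vertices lie on one path. -/
def IsCaterpillar {V : Type*} [Fintype V] (T : SimpleGraph V) [DecidableRel T.Adj] : Prop :=
  T.IsTree ∧ ∃ (a b : V) (p : T.Walk a b), p.IsPath ∧ ∀ v, ¬ IsLeafVertex T v → v ∈ p.support

/-- `v 0, …, v (n - 1)` lists, in order along the path, the vertices of the path obtained from `T`
by deleting all leaves. -/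
structure IsSpine {V : Type*} [Fintype V] (T : SimpleGraph V) [DecidableRel T.Adj]
    {n : ℕ} (v : Fin n → V) : Prop where
  injective : Function.Injective v
  adj : ∀ i j : Fin n, (i : ℕ) + 1 = j → T.Adj (v i) (v j)
  range_eq : Set.range v = {x | ¬ IsLeafVertex T x}

/-- The number of leaf neighbours of `x`. -/
def leafDegree {V : Type*} [Fintype V] (T : SimpleGraph V) [DecidableRel T.Adj] (x : V) : ℕ :=
  ((T.neighborFinset x).filter (fun y => IsLeafVertex T y)).card

/-- `ℓ(s) = ⌈(s+1)/2⌉ ⌊(s+1)/2⌋`. -/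
def pyramidSize (s : ℕ) : ℕ := ⌈((s : ℚ) + 1) / 2⌉₊ * ⌊((s : ℚ) + 1) / 2⌋₊

/-! Number the spine vertices `0, …, n - 1`.

Sufficiency. If the spine weights form a pyramid `1, 2, …, 2, 1`, every slope can be drained uphill,
leaves included, into the top, so it is enough to build the pyramid from the constant `1`. A unit
missing at height `t + 1` above `y` is a cell; it is to be paid for by a leaf at distance less than
`t` from `y`, so a cell behaves like an interval of admissible leaf positions. The condition with
`ℓ(s)` is Hall's condition for cells against leaves, tested on intervals. A matching is not enough,
since every intermediate configuration must allow the next move. The pyramid is therefore dismantled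
backwards: `IsProfile.exists_removable` finds a weak local maximum `y` and a leaf position `x` on a
slope of `y` such that deleting the top cell of `y` and one leaf at `x` preserves Hall's condition.
The cell count is supermodular and the leaf count modular, so overlapping or touching tight
intervals have tight unions; without a removable pair, a sweep to the right would never stop. Played
forwards, a deletion is a unit sent up the slope from `x` to `y`, followed by the absorption of a
leaf at `x` (`IsProfile.fill`).

Necessity. If an interval of internal spine vertices has too few leaves, contract each side of it
and compare weights with the pyramid `h` on the interval and its two neighbours. `Blocked` is
invariant: two positions lie above `h`, and what lies between them, unused leaves included, cannot
fill `h` there. A unit entering a vertex below `h` comes from one not above `h`, because the giver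
has at most the receiver's weight and `h` changes by at most one per step. So two classes stay
nonempty forever (`IsSpine.blocked_step`, `IsSpine.pyramidSize_le`). -/

open Finset

/-! ### Cells, leaves and Hall's condition -/

/-- The number of pairs `(y, t)` with `1 ≤ t < h y` for which `y - t + 1, …, y + t - 1` lie in
`[l, r)`. -/
def cellCount (N : ℕ) (h : ℕ → ℕ) (l r : ℕ) : ℕ :=
  ∑ y ∈ range N, min (h y - 1) (min (y + 1 - l) (r - y))

theorem sum_Ico_add_sum_range (d : ℕ → ℕ) {l r : ℕ} (h : l ≤ r) :
    ∑ j ∈ range l, d j + ∑ j ∈ Ico l r, d j = ∑ j ∈ range r, d j :=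
  sum_range_add_sum_Ico d h

theorem min_min_supermodular (k a₁ b₁ a₂ b₂ : ℕ) :
    min k (min a₁ b₁) + min k (min a₂ b₂) ≤
      min k (min (max a₁ a₂) (max b₁ b₂)) + min k (min (min a₁ a₂) (min b₁ b₂)) := by
  rcases le_total a₁ a₂ with h | h <;> rcases le_total b₁ b₂ with h' | h' <;>
    simp only [max_eq_left, max_eq_right, min_eq_left h, min_eq_right h, min_eq_left h',
      min_eq_right h', h, h'] <;> omega

theorem min_min_supermodular_strict {k a₁ b₁ a₂ b₂ : ℕ} (h₁ : min a₁ b₁ < k) (h₂ : min a₂ b₂ < k)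
    (h₃ : k ≤ min (max a₁ a₂) (max b₁ b₂)) :
    min k (min a₁ b₁) + min k (min a₂ b₂) <
      min k (min (max a₁ a₂) (max b₁ b₂)) + min k (min (min a₁ a₂) (min b₁ b₂)) := by
  rw [min_eq_left h₃]
  rcases le_total a₁ a₂ with h | h <;> rcases le_total b₁ b₂ with h' | h' <;>
    simp only [max_eq_left, max_eq_right, min_eq_left h, min_eq_right h, min_eq_left h',
      min_eq_right h', h, h'] at * <;> omega

/-- A cell inside either interval is inside their hull, and a cell inside both is inside their
intersection. For one column this is `min_min_supermodular`. -/
theorem cellCount_supermodular (N : ℕ) (h : ℕ → ℕ) (l₁ r₁ l₂ r₂ : ℕ) :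
    cellCount N h l₁ r₁ + cellCount N h l₂ r₂ ≤
      cellCount N h (min l₁ l₂) (max r₁ r₂) + cellCount N h (max l₁ l₂) (min r₁ r₂) := by
  unfold cellCount
  rw [← sum_add_distrib, ← sum_add_distrib]
  refine sum_le_sum fun y _ => ?_
  rw [show y + 1 - min l₁ l₂ = max (y + 1 - l₁) (y + 1 - l₂) by omega,
    show max r₁ r₂ - y = max (r₁ - y) (r₂ - y) by omega,
    show y + 1 - max l₁ l₂ = min (y + 1 - l₁) (y + 1 - l₂) by omega,
    show min r₁ r₂ - y = min (r₁ - y) (r₂ - y) by omega]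
  exact min_min_supermodular _ _ _ _ _

/-- The top cell of column `y` lies in the hull but in neither interval, so it is counted only on
the right. -/
theorem cellCount_supermodular_strict (N : ℕ) (h : ℕ → ℕ) (l₁ r₁ l₂ r₂ y : ℕ) (hy : y < N)
    (h₁ : ¬ (l₁ + h y ≤ y + 2 ∧ y + h y ≤ r₁ + 1)) (h₂ : ¬ (l₂ + h y ≤ y + 2 ∧ y + h y ≤ r₂ + 1))
    (h₃ : min l₁ l₂ + h y ≤ y + 2 ∧ y + h y ≤ max r₁ r₂ + 1) (h2 : 2 ≤ h y) :
    cellCount N h l₁ r₁ + cellCount N h l₂ r₂ <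
      cellCount N h (min l₁ l₂) (max r₁ r₂) + cellCount N h (max l₁ l₂) (min r₁ r₂) := by
  have key : ∀ y, y + 1 - min l₁ l₂ = max (y + 1 - l₁) (y + 1 - l₂) ∧
      max r₁ r₂ - y = max (r₁ - y) (r₂ - y) ∧
      y + 1 - max l₁ l₂ = min (y + 1 - l₁) (y + 1 - l₂) ∧
      min r₁ r₂ - y = min (r₁ - y) (r₂ - y) := fun y => by omega
  unfold cellCount
  rw [← sum_add_distrib, ← sum_add_distrib]
  refine sum_lt_sum (fun y _ => ?_) ⟨y, mem_range.2 hy, ?_⟩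
  · rw [(key y).1, (key y).2.1, (key y).2.2.1, (key y).2.2.2]
    exact min_min_supermodular _ _ _ _ _
  · rw [(key y).1, (key y).2.1, (key y).2.2.1, (key y).2.2.2]
    exact min_min_supermodular_strict (by omega) (by omega) (by omega)

/-- Every interval `[l, r)` has at least as many leaves as cells. -/
def HallCondition (N : ℕ) (h d : ℕ → ℕ) : Prop :=
  ∀ l r, l ≤ r → cellCount N h l r ≤ ∑ j ∈ Ico l r, d j

/-- The common point `x`, possibly just an endpoint, makes the hull equal to the union, so leaf
counts are modular. Supermodularity of cells then forces equality in Hall's condition, and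
strictness would violate it. -/
theorem tight_union {N : ℕ} {h d : ℕ → ℕ} (hall : HallCondition N h d) {l₁ r₁ l₂ r₂ x y : ℕ}
    (hy : y < N) (h2 : 2 ≤ h y) (hl₁ : l₁ ≤ x) (hr₁ : x ≤ r₁) (hl₂ : l₂ ≤ x) (hr₂ : x ≤ r₂)
    (t₁ : cellCount N h l₁ r₁ = ∑ j ∈ Ico l₁ r₁, d j)
    (t₂ : cellCount N h l₂ r₂ = ∑ j ∈ Ico l₂ r₂, d j)
    (h₁ : ¬ (l₁ + h y ≤ y + 2 ∧ y + h y ≤ r₁ + 1))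
    (h₂ : ¬ (l₂ + h y ≤ y + 2 ∧ y + h y ≤ r₂ + 1)) :
    cellCount N h (min l₁ l₂) (max r₁ r₂) = ∑ j ∈ Ico (min l₁ l₂) (max r₁ r₂), d j ∧
      ¬ (min l₁ l₂ + h y ≤ y + 2 ∧ y + h y ≤ max r₁ r₂ + 1) := by
  have hs := cellCount_supermodular N h l₁ r₁ l₂ r₂
  have a₁ := hall (min l₁ l₂) (max r₁ r₂) (by omega)
  have a₂ := hall (max l₁ l₂) (min r₁ r₂) (by omega)
  have hm : ∑ j ∈ Ico l₁ r₁, d j + ∑ j ∈ Ico l₂ r₂, d j =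
      ∑ j ∈ Ico (min l₁ l₂) (max r₁ r₂), d j + ∑ j ∈ Ico (max l₁ l₂) (min r₁ r₂), d j := by
    have e₁ := sum_Ico_add_sum_range d (hl₁.trans hr₁)
    have e₂ := sum_Ico_add_sum_range d (hl₂.trans hr₂)
    have e₃ := sum_Ico_add_sum_range d (show min l₁ l₂ ≤ max r₁ r₂ by omega)
    have e₄ := sum_Ico_add_sum_range d (show max l₁ l₂ ≤ min r₁ r₂ by omega)
    rcases le_total l₁ l₂ with hl | hl <;> rcases le_total r₁ r₂ with hr | hr <;>
      simp only [min_eq_left, min_eq_right, max_eq_left, max_eq_right, hl, hr] at * <;> omega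
  refine ⟨by omega, fun h₃ => ?_⟩
  have := cellCount_supermodular_strict N h l₁ r₁ l₂ r₂ y hy h₁ h₂ h₃ h2
  omega

/-! ### Profiles and removable cells -/

/-- Integer profiles whose neighbouring values differ by at most one, equal to one at `0` and
from `N` on. -/
structure IsProfile (N : ℕ) (h : ℕ → ℕ) : Prop where
  pos : ∀ j, 1 ≤ h j
  zero : h 0 = 1
  eventually : ∀ j, N ≤ j → h j = 1
  up : ∀ j, h (j + 1) ≤ h j + 1
  down : ∀ j, h j ≤ h (j + 1) + 1

namespace IsProfile

variable {N : ℕ} {h : ℕ → ℕ}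

theorem le_add (hh : IsProfile N h) (j k : ℕ) : h (j + k) ≤ h j + k ∧ h j ≤ h (j + k) + k := by
  induction k with
  | zero => simp
  | succ k ih =>
    have := hh.up (j + k); have := hh.down (j + k)
    rw [← add_assoc]; omega

theorem le_of_le (hh : IsProfile N h) {i j : ℕ} (hij : i ≤ j) :
    h j + i ≤ h i + j ∧ h i + i ≤ h j + j := by
  obtain ⟨k, rfl⟩ := Nat.exists_eq_add_of_le hij
  have := hh.le_add i k; omega

theorem lt_of_two_le (hh : IsProfile N h) {j : ℕ} (hj : 2 ≤ h j) : j < N := by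
  by_contra hn
  have := hh.eventually j (by omega); omega

/-- Climb to the right from `p` until the first step that does not ascend; the climb ends because
the profile is eventually `1`. -/
theorem exists_weakMax (hh : IsProfile N h) {p : ℕ} (hp : 2 ≤ h p) (hpp : h (p - 1) ≤ h p) :
    ∃ y, p ≤ y ∧ h (y + 1) ≤ h y ∧ h (y - 1) ≤ h y ∧ h y + p = h p + y := by
  have hex : ∃ k, h (p + k + 1) ≤ h (p + k) := by
    by_contra hne
    push Not at hne
    have : ∀ k, h p + k ≤ h (p + k) := by
      intro k
      induction k with
      | zero => simp
      | succ k ih =>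
        have := hne k
        rw [add_assoc] at this
        omega
    have h1 := this N
    have h2 := hh.eventually (p + N) (by omega)
    omega
  classical
  set k := Nat.find hex with hk
  have hmin : ∀ i, i < k → h (p + i) < h (p + i + 1) := fun i hi => by
    have := Nat.find_min hex hi; omega
  have hval : ∀ i, i ≤ k → h (p + i) = h p + i := by
    intro i hi
    induction i with
    | zero => simp
    | succ i ih =>
      have := ih (by omega); have := hmin i (by omega); have := hh.up (p + i)
      rw [← add_assoc]; omega
  refine ⟨p + k, by omega, Nat.find_spec hex, ?_, by have := hval k le_rfl; omega⟩
  rcases Nat.eq_zero_or_pos k with h0 | h0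
  · rw [h0]; simpa using hpp
  · have a := hval k le_rfl; have b := hval (k - 1) (by omega)
    rw [show p + k - 1 = p + (k - 1) by omega]; omega

/-- The induction hypothesis of the sweep that finds a removable cell. -/
def SweepState (N : ℕ) (h d : ℕ → ℕ) (x : ℕ) : Prop :=
  ∃ y l r, h (y + 1) ≤ h y ∧ h (y - 1) ≤ h y ∧ 2 ≤ h x ∧
    (x ≤ y → h x + y = h y + x) ∧ (y ≤ x → h x + x = h y + y) ∧
    l ≤ x ∧ x ≤ r ∧ cellCount N h l r = ∑ j ∈ Ico l r, d j ∧ l + h y ≤ y + 2 ∧ r + 1 < y + h y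

/-- Hall's condition survives deleting the top cell of `y` and a leaf at `x` exactly when each tight
interval containing `x` also contains that cell. If every pair fails, the failing tight intervals
merge into one that reaches ever further right while still missing the right end of the current
peak's top cell. -/
theorem exists_removable (hh : IsProfile N h) {d : ℕ → ℕ} (hall : HallCondition N h d)
    (hne : ∃ j, h j ≠ 1) :
    ∃ y x, h (y + 1) ≤ h y ∧ h (y - 1) ≤ h y ∧ 2 ≤ h x ∧ 2 ≤ h y ∧
      (x ≤ y → h x + y = h y + x) ∧ (y ≤ x → h x + x = h y + y) ∧
      ∀ l r, l ≤ x → x < r → cellCount N h l r = ∑ j ∈ Ico l r, d j →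
        l + h y ≤ y + 2 ∧ y + h y ≤ r + 1 := by
  by_contra hstuck
  push Not at hstuck
  have step : ∀ x, SweepState N h d x → SweepState N h d (x + 1) := by
    rintro x ⟨y, l, r, hy1, hy2, hx2, hxy, hyx, hl, hr, ht, hly, hry⟩
    have hy : 2 ≤ h y := by
      rcases le_total x y with hc | hc
      · have := hxy hc; omega
      · have := hyx hc; omega
    -- The pair `(y, x)` fails because of a tight interval reaching beyond `x`; its union with the
    -- current one is tight, still misses the top cell of `y`, and reaches `x + 1`.
    obtain ⟨l', r', hl', hr', ht', hn'⟩ := hstuck y x hy1 hy2 hx2 hy hxy hyx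
    obtain ⟨tu, nu⟩ := tight_union hall (hh.lt_of_two_le hy) hy hl hr hl' hr'.le ht ht'
      (by omega) (fun hc => by have := hn' hc.1; omega)
    set L := min l l' with hL
    set R := max r r' with hR
    have hLy : L + h y ≤ y + 2 := by omega
    have hRy : R + 1 < y + h y := by by_contra hc; exact nu ⟨hLy, by omega⟩
    have hup := hh.up x
    have hdown := hh.down x
    by_cases hc : x < y
    · have h1 := hxy hc.le
      have h2 := hh.le_of_le (show x + 1 ≤ y by omega)
      refine ⟨y, L, R, hy1, hy2, by omega, by omega, ?_, by omega, by omega, tu, hLy, hRy⟩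
      intro hc'
      have : x + 1 = y := by omega
      rw [this]
    · have h1 := hyx (by omega)
      by_cases hd : h (x + 1) < h x
      · exact ⟨y, L, R, hy1, hy2, by omega, by omega, by omega, by omega, by omega, tu,
          hLy, hRy⟩
      -- The descent from `y` ends at `x`, so the sweep passes to the next peak `y'`. As slopes are
      -- at most one, the top cell of `y'` begins and ends no earlier than that of `y`, which keeps
      -- both inequalities.
      · obtain ⟨y', hy'1, hy'2, hy'3, hy'4⟩ :=
          hh.exists_weakMax (p := x + 1) (by omega) (by simpa using hd)
        have h3 := hh.le_of_le (show y ≤ y' by omega)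
        have h4 := hh.le_of_le (show x + 1 ≤ y' by omega)
        refine ⟨y', L, R, hy'2, hy'3, by omega, by omega, ?_, by omega, by omega, tu,
          by omega, by omega⟩
        intro hc'
        have : x + 1 = y' := by omega
        rw [this]
  have start : ∃ a, SweepState N h d a := by
    classical
    have hex : ∃ j, 2 ≤ h j := by
      obtain ⟨j, hj⟩ := hne
      exact ⟨j, by have := hh.pos j; omega⟩
    set a := Nat.find hex with ha
    have ha2 : 2 ≤ h a := Nat.find_spec hex
    have ha0 : a ≠ 0 := fun h0 => by rw [h0, hh.zero] at ha2; omega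
    have hprev : h (a - 1) = 1 := by
      have := Nat.find_min hex (m := a - 1) (by omega)
      have := hh.pos (a - 1); omega
    have hup := hh.up (a - 1)
    rw [show a - 1 + 1 = a by omega] at hup
    obtain ⟨y, h1, h2, h3, h4⟩ := hh.exists_weakMax ha2 (by omega)
    -- The empty interval at `a` is tight. Since `h a = 2` and the profile climbs steadily from `a`
    -- to `y`, the top cell of `y` begins exactly at `a`.
    refine ⟨a, y, a, a, h2, h3, ha2, by omega, ?_, le_rfl, le_rfl, ?_, by omega, by omega⟩
    · intro hc
      have : a = y := by omega
      rw [this]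
    · simp only [cellCount, Ico_self, sum_empty, sum_eq_zero_iff]
      intro i _
      omega
  obtain ⟨a, ha⟩ := start
  have all : ∀ k, SweepState N h d (a + k) := fun k => by
    induction k with
    | zero => exact ha
    | succ k ih => exact step _ ih
  obtain ⟨_, _, _, _, _, h2, _⟩ := all N
  have := hh.lt_of_two_le h2
  omega

theorem remove_weakMax (hh : IsProfile N h) {y : ℕ} (hy1 : h (y + 1) ≤ h y) (hy2 : h (y - 1) ≤ h y)
    (hy : 2 ≤ h y) : IsProfile N (Function.update h y (h y - 1)) := by
  have hy0 : y ≠ 0 := fun h0 => by rw [h0, hh.zero] at hy; omega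
  have hyN := hh.lt_of_two_le hy
  refine ⟨fun j => ?_, ?_, fun j hj => ?_, fun j => ?_, fun j => ?_⟩
  · rw [Function.update_apply]; split_ifs with hj
    · omega
    · exact hh.pos j
  · rw [Function.update_of_ne (Ne.symm hy0), hh.zero]
  · rw [Function.update_of_ne (by omega), hh.eventually j hj]
  all_goals
    have := hh.up j; have := hh.down j
    rw [Function.update_apply, Function.update_apply]
    rcases eq_or_ne (j + 1) y with rfl | h1
    · rw [Nat.add_sub_cancel] at hy2
      rw [if_pos rfl, if_neg (by omega)]; omega
    rw [if_neg h1]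
    rcases eq_or_ne j y with rfl | h2
    · rw [if_pos rfl]; omega
    · rw [if_neg h2]; assumption

end IsProfile

theorem cellCount_remove {N : ℕ} {h : ℕ → ℕ} {y : ℕ} (hy : y < N) (h2 : 2 ≤ h y) (l r : ℕ) :
    cellCount N (Function.update h y (h y - 1)) l r +
      (if l + h y ≤ y + 2 ∧ y + h y ≤ r + 1 then 1 else 0) = cellCount N h l r := by
  unfold cellCount
  rw [← add_sum_erase _ _ (mem_range.2 hy), ← add_sum_erase (range N) (fun y => min (h y - 1) _)
    (mem_range.2 hy)]
  have : ∑ x ∈ (range N).erase y, min (Function.update h y (h y - 1) x - 1) (min (x + 1 - l) (r - x))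
      = ∑ x ∈ (range N).erase y, min (h x - 1) (min (x + 1 - l) (r - x)) :=
    sum_congr rfl fun x hx => by rw [Function.update_of_ne (ne_of_mem_erase hx)]
  rw [this, Function.update_self]
  split_ifs <;> omega

theorem sum_Ico_remove {d : ℕ → ℕ} {x : ℕ} (hx : 0 < d x) (l r : ℕ) :
    ∑ j ∈ Ico l r, Function.update d x (d x - 1) j + (if l ≤ x ∧ x < r then 1 else 0) =
      ∑ j ∈ Ico l r, d j := by
  split_ifs with hc
  · have hm : x ∈ Ico l r := mem_Ico.2 hc
    rw [sum_update_of_mem hm, ← add_sum_erase _ _ hm, sdiff_singleton_eq_erase]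
    omega
  · rw [sum_update_of_notMem (by simpa using hc), add_zero]

/-- One cell of a profile satisfying the Hall condition can be removed together with a leaf that
is able to fill it. -/
theorem HallCondition.exists_remove {N : ℕ} {h d : ℕ → ℕ} (hh : IsProfile N h)
    (hall : HallCondition N h d) (hne : ∃ j, h j ≠ 1) :
    ∃ y x, h (y + 1) ≤ h y ∧ h (y - 1) ≤ h y ∧ 2 ≤ h x ∧ 2 ≤ h y ∧ 0 < d x ∧
      (x ≤ y → h x + y = h y + x) ∧ (y ≤ x → h x + x = h y + y) ∧
      HallCondition N (Function.update h y (h y - 1)) (Function.update d x (d x - 1)) := by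
  obtain ⟨y, x, h1, h2, h3, h4, h5, h6, hA⟩ := hh.exists_removable hall hne
  have hxN := hh.lt_of_two_le h3
  have hyN := hh.lt_of_two_le h4
  have hdx : 0 < d x := by
    -- As `2 ≤ h x`, the lowest cell above `x` lies in the one-point interval, so Hall's condition
    -- supplies a leaf there.
    have h7 := hall x (x + 1) (by omega)
    have h8 : 0 < cellCount N h x (x + 1) :=
      sum_pos' (fun _ _ => Nat.zero_le _) ⟨x, mem_range.2 hxN, by omega⟩
    simp only [Nat.Ico_succ_singleton, sum_singleton] at h7
    omega
  refine ⟨y, x, h1, h2, h3, h4, hdx, h5, h6, fun l r hlr => ?_⟩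
  have e1 := cellCount_remove hyN h4 l r
  have e2 := sum_Ico_remove hdx l r
  have e3 := hall l r hlr
  have e4 := hA l r
  -- A non-tight interval can afford the loss of a leaf; a tight one containing `x` loses the cell
  -- too.
  split_ifs at e1 e2 <;> omega

/-! ### The game on the spine -/

/-- Consecutive positions on the path `0, …, n - 1`. -/
def PathAdj (n i j : ℕ) : Prop := i < n ∧ j < n ∧ (i + 1 = j ∨ j + 1 = i)

/-- The moves of the acquisition game on a caterpillar: `s.1 j` is the weight of the `j`-th spine
vertex and `s.2 j` the number of its leaves that still carry their unit. -/
inductive SpineMove (n : ℕ) : (ℕ → ℕ) × (ℕ → ℕ) → (ℕ → ℕ) × (ℕ → ℕ) → Prop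
  | absorb (w e : ℕ → ℕ) (j : ℕ) (hj : j < n) (hw : 0 < w j) (he : 0 < e j) :
      SpineMove n (w, e) (Function.update w j (w j + 1), Function.update e j (e j - 1))
  | pass (w e : ℕ → ℕ) (i j : ℕ) (hij : PathAdj n i j) (hw : 0 < w i) (hle : w i ≤ w j) :
      SpineMove n (w, e) (Function.update (Function.update w i (w i - 1)) j (w j + 1), e)

/-- Reachability by a sequence of moves. -/
abbrev SpineReach (n : ℕ) := Relation.ReflTransGen (SpineMove n)

/-- Unused leaves do not hinder any move. -/
theorem SpineReach.add_leaves {n : ℕ} {s t : (ℕ → ℕ) × (ℕ → ℕ)} (h : SpineReach n s t)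
    (f : ℕ → ℕ) : SpineReach n (s.1, s.2 + f) (t.1, t.2 + f) := by
  induction h with
  | refl => exact .refl
  | tail _ hm ih =>
    refine ih.tail ?_
    cases hm with
    | absorb w e j hj hw he =>
      have := SpineMove.absorb (n := n) w (e + f) j hj hw (by simp; omega)
      convert this using 2
      funext i
      simp only [Pi.add_apply, Function.update_apply]
      split_ifs with hi
      · subst hi; omega
      · rfl
    | pass w e i j hij hw hle => exact SpineMove.pass w (e + f) i j hij hw hle

/-- `p 0, …, p r` is a path. -/
structure IsSpineChain (n : ℕ) (p : ℕ → ℕ) (r : ℕ) : Prop where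
  adj : ∀ i, i < r → PathAdj n (p i) (p (i + 1))
  inj : ∀ i j, i ≤ r → j ≤ r → p i = p j → i = j

namespace IsSpineChain

variable {n r : ℕ} {p : ℕ → ℕ}

theorem ne (hp : IsSpineChain n p r) {i j : ℕ} (hi : i ≤ r) (hj : j ≤ r) (hij : i ≠ j) :
    p i ≠ p j := fun h => hij (hp.inj i j hi hj h)

theorem tail (hp : IsSpineChain n p (r + 1)) : IsSpineChain n (fun i => p (i + 1)) r :=
  ⟨fun i hi => hp.adj (i + 1) (by omega), fun i j hi hj h => by
    have := hp.inj (i + 1) (j + 1) (by omega) (by omega) h; omega⟩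

theorem init (hp : IsSpineChain n p (r + 1)) : IsSpineChain n p r :=
  ⟨fun i hi => hp.adj i (by omega), fun i j hi hj h => hp.inj i j (by omega) (by omega) h⟩

/-- A unit travels along an increasing chain whose first step may be flat. -/
theorem push (hp : IsSpineChain n p (r + 1)) (w e : ℕ → ℕ) (h0 : 0 < w (p 0))
    (h1 : w (p 0) ≤ w (p 1)) (hlt : ∀ i, 1 ≤ i → i < r + 1 → w (p i) < w (p (i + 1))) :
    SpineReach n (w, e) (Function.update (Function.update w (p 0) (w (p 0) - 1)) (p (r + 1))
      (w (p (r + 1)) + 1), e) := by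
  induction r generalizing p w with
  | zero => exact .single (.pass w e _ _ (hp.adj 0 (by omega)) h0 h1)
  | succ r ih =>
    refine .head (.pass w e _ _ (hp.adj 0 (by omega)) h0 h1) ?_
    have n01 := hp.ne (i := 0) (j := 1) (by omega) (by omega) (by omega)
    have hv : ∀ i, 2 ≤ i → i ≤ r + 2 →
        Function.update (Function.update w (p 0) (w (p 0) - 1)) (p (0 + 1)) (w (p (0 + 1)) + 1) (p i)
          = w (p i) := fun i hi hi' => by
      rw [Function.update_of_ne (hp.ne hi' (by omega) (by omega)),
        Function.update_of_ne (hp.ne hi' (by omega) (by omega))]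
    have := ih hp.tail
      (Function.update (Function.update w (p 0) (w (p 0) - 1)) (p (0 + 1)) (w (p (0 + 1)) + 1))
      (by simp) (by
        have := hlt 1 le_rfl (by omega)
        rw [Function.update_self, hv _ (by omega) (by omega)]; exact this)
      (fun i hi hi' => by
        rw [hv _ (by omega) (by omega), hv _ (by omega) (by omega)]
        exact hlt (i + 1) (by omega) (by omega))
    convert this using 2
    have a := hp.ne (i := r + 1 + 1) (j := 0) (by omega) (by omega) (by omega)
    have b := hp.ne (i := r + 1 + 1) (j := 1) (by omega) (by omega) (by omega)
    funext x
    simp only [Function.update_apply, zero_add]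
    split_ifs <;> simp_all

/-- A unit travels along an increasing chain whose last step may be flat. -/
theorem pull (hp : IsSpineChain n p (r + 1)) (w e : ℕ → ℕ) (h0 : 0 < w (p 0))
    (h1 : w (p r) ≤ w (p (r + 1))) (hlt : ∀ i, i < r → w (p i) < w (p (i + 1))) :
    SpineReach n (w, e) (Function.update (Function.update w (p 0) (w (p 0) - 1)) (p (r + 1))
      (w (p (r + 1)) + 1), e) := by
  induction r generalizing w with
  | zero => exact .single (.pass w e _ _ (hp.adj 0 (by omega)) h0 h1)
  | succ r ih =>
    have hpos : 0 < w (p (r + 1)) := by have := hlt r (by omega); omega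
    -- The last hop is made first: it lowers `p (r + 1)` by one, so the strict step before it
    -- becomes at worst flat.
    refine .head (.pass w e _ _ (hp.adj (r + 1) (by omega)) hpos h1) ?_
    set w' := Function.update (Function.update w (p (r + 1)) (w (p (r + 1)) - 1)) (p (r + 1 + 1))
      (w (p (r + 1 + 1)) + 1) with hw'
    have hv : ∀ i, i ≤ r → w' (p i) = w (p i) := fun i hi => by
      rw [hw', Function.update_of_ne (hp.ne (by omega) (by omega) (by omega)),
        Function.update_of_ne (hp.ne (by omega) (by omega) (by omega))]
    have hv1 : w' (p (r + 1)) = w (p (r + 1)) - 1 := by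
      rw [hw', Function.update_of_ne (hp.ne (by omega) (by omega) (by omega)), Function.update_self]
    have := ih hp.init w' (by rw [hv 0 (by omega)]; exact h0)
      (by rw [hv r le_rfl, hv1]; have := hlt r (by omega); omega)
      (fun i hi => by
        rw [hv _ (by omega), hv _ (by omega)]; exact hlt i (by omega))
    convert this using 2
    rw [hv 0 (by omega), hv1]
    have a := hp.ne (i := r + 1) (j := 0) (by omega) (by omega) (by omega)
    have b := hp.ne (i := r + 1 + 1) (j := 0) (by omega) (by omega) (by omega)
    have c := hp.ne (i := r + 1 + 1) (j := r + 1) (by omega) (by omega) (by omega)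
    funext x
    simp only [hw', Function.update_apply]
    split_ifs <;> (simp_all; try omega)

/-- The first vertex of an increasing chain gives everything it can collect to the last one. -/
theorem drain_first (hp : IsSpineChain n p (r + 1)) (w e : ℕ → ℕ) (h0 : 0 < w (p 0))
    (hlt : ∀ i, i < r + 1 → w (p i) < w (p (i + 1))) :
    SpineReach n (w, e) (Function.update (Function.update w (p 0) 0) (p (r + 1))
      (w (p (r + 1)) + w (p 0) + e (p 0)), Function.update e (p 0) 0) := by
  have hne := hp.ne (i := 0) (j := r + 1) (by omega) (by omega) (by omega)
  have own : ∀ k (w : ℕ → ℕ) (e : ℕ → ℕ), w (p 0) = k →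
      (∀ i, i < r + 1 → w (p i) < w (p (i + 1))) →
      SpineReach n (w, e) (Function.update (Function.update w (p 0) 0) (p (r + 1))
        (w (p (r + 1)) + w (p 0)), e) := by
    intro k
    induction k with
    | zero =>
      intro w e hk _
      rw [hk, add_zero, (Function.update_eq_self_iff (f := w) (a := p 0)).2 hk.symm,
        Function.update_eq_self]
    | succ k ih =>
      intro w e hk hlt
      refine (hp.push w e (by omega) (hlt 0 (by omega)).le (fun i _ hi => hlt i hi)).trans ?_
      set w' := Function.update (Function.update w (p 0) (w (p 0) - 1)) (p (r + 1))
        (w (p (r + 1)) + 1) with hw'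
      have h0' : w' (p 0) = k := by rw [hw', Function.update_of_ne hne, Function.update_self]; omega
      have hr' : w' (p (r + 1)) = w (p (r + 1)) + 1 := by rw [hw', Function.update_self]
      have hm : ∀ i, 1 ≤ i → i ≤ r → w' (p i) = w (p i) := fun i hi hi' => by
        rw [hw', Function.update_of_ne (hp.ne (by omega) (by omega) (by omega)),
          Function.update_of_ne (hp.ne (by omega) (by omega) (by omega))]
      have := ih w' e h0' (fun i hi => by
        have a := hlt i hi
        rcases Nat.eq_zero_or_pos i with h | h
        · subst h
          rcases Nat.eq_zero_or_pos r with h' | h'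
          · subst h'; rw [h0', hr']; omega
          · rw [h0', hm 1 le_rfl h']; simp only [zero_add] at a; omega
        · rw [hm i h (by omega)]
          rcases Nat.lt_or_ge i r with h' | h'
          · rw [hm (i + 1) (by omega) (by omega)]; exact a
          · have : i = r := by omega
            subst this
            rw [hr']; omega)
      convert this using 2
      rw [h0', hr', hk]
      funext x
      simp only [hw', Function.update_apply]
      split_ifs <;> first | rfl | omega
  have main : ∀ k (w e : ℕ → ℕ), e (p 0) = k → 0 < w (p 0) →
      (∀ i, i < r + 1 → w (p i) < w (p (i + 1))) →
      SpineReach n (w, e) (Function.update w (p (r + 1)) (w (p (r + 1)) + k),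
        Function.update e (p 0) 0) := by
    intro k
    induction k with
    | zero =>
      intro w e hk _ _
      rw [add_zero, Function.update_eq_self, Function.update_eq_self_iff.2 hk.symm]
    | succ k ih =>
      intro w e hk h0 hlt
      refine .head (.absorb w e (p 0) (hp.adj 0 (by omega)).1 h0 (by omega)) ?_
      have hv : ∀ i, 1 ≤ i → i ≤ r + 1 →
          Function.update w (p 0) (w (p 0) + 1) (p i) = w (p i) := fun i hi hi' => by
        rw [Function.update_of_ne (hp.ne (by omega) (by omega) (by omega))]
      refine (hp.push (Function.update w (p 0) (w (p 0) + 1)) _ (by simp)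
        (by rw [Function.update_self, hv 1 le_rfl (by omega)]; exact hlt 0 (by omega))
        (fun i hi hi' => by
          rw [hv i hi (by omega), hv (i + 1) (by omega) (by omega)]; exact hlt i hi')).trans ?_
      rw [hv (r + 1) (by omega) le_rfl, Function.update_self, Nat.add_sub_cancel,
        Function.update_idem, Function.update_eq_self]
      have hv' : ∀ i, i ≤ r →
          Function.update w (p (r + 1)) (w (p (r + 1)) + 1) (p i) = w (p i) := fun i hi => by
        rw [Function.update_of_ne (hp.ne (by omega) (by omega) (by omega))]
      have := ih (Function.update w (p (r + 1)) (w (p (r + 1)) + 1))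
        (Function.update e (p 0) (e (p 0) - 1)) (by rw [Function.update_self]; omega)
        (by rw [hv' 0 (by omega)]; exact h0)
        (fun i hi => by
          have a := hlt i hi
          rw [hv' i (by omega)]
          rcases Nat.lt_or_ge i r with h' | h'
          · rw [hv' (i + 1) (by omega)]; exact a
          · have : i = r := by omega
            subst this
            rw [Function.update_self]; omega)
      rw [Function.update_self, Function.update_idem, Function.update_idem, add_assoc,
        add_comm 1 k] at this
      exact this
  -- Leaves are passed on before the vertex's own weight, because an empty vertex cannot absorb a
  -- leaf.
  refine (main _ w e rfl h0 hlt).trans ?_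
  have hv' : ∀ i, i ≤ r →
      Function.update w (p (r + 1)) (w (p (r + 1)) + e (p 0)) (p i) = w (p i) := fun i hi => by
    rw [Function.update_of_ne (hp.ne (by omega) (by omega) (by omega))]
  have := own _ (Function.update w (p (r + 1)) (w (p (r + 1)) + e (p 0)))
    (Function.update e (p 0) 0) rfl (fun i hi => by
      have a := hlt i hi
      rw [hv' i (by omega)]
      rcases Nat.lt_or_ge i r with h' | h'
      · rw [hv' (i + 1) (by omega)]; exact a
      · have : i = r := by omega
        subst this
        rw [Function.update_self]; omega)
  convert this using 2
  rw [hv' 0 (by omega), Function.update_self]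
  funext x
  simp only [Function.update_apply]
  split_ifs <;> first | rfl | omega

/-- All vertices of an increasing chain give everything they can collect to the last one. -/
theorem drain (hp : IsSpineChain n p r) (w e : ℕ → ℕ) (h0 : 0 < w (p 0))
    (hlt : ∀ i, i < r → w (p i) < w (p (i + 1))) :
    ∃ w' e', SpineReach n (w, e) (w', e') ∧ (∀ i, i < r → w' (p i) = 0 ∧ e' (p i) = 0) ∧
      w (p r) + r ≤ w' (p r) ∧ (∀ j, (∀ i, i ≤ r → j ≠ p i) → w' j = w j) ∧
      ∀ j, (∀ i, i < r → j ≠ p i) → e' j = e j := by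
  induction r generalizing p w e with
  | zero => exact ⟨w, e, .refl, by simp, by simp, fun _ _ => rfl, fun _ _ => rfl⟩
  | succ r ih =>
    have h1 := hp.drain_first w e h0 hlt
    set w₁ := Function.update (Function.update w (p 0) 0) (p (r + 1))
      (w (p (r + 1)) + w (p 0) + e (p 0)) with hw₁
    set e₁ := Function.update e (p 0) 0 with he₁
    have hv : ∀ i, 1 ≤ i → i ≤ r → w₁ (p i) = w (p i) := fun i hi hi' => by
      rw [hw₁, Function.update_of_ne (hp.ne (by omega) (by omega) (by omega)),
        Function.update_of_ne (hp.ne (by omega) (by omega) (by omega))]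
    have hr₁ : w₁ (p (r + 1)) = w (p (r + 1)) + w (p 0) + e (p 0) := by
      rw [hw₁, Function.update_self]
    have h0₁ : w₁ (p 0) = 0 := by
      rw [hw₁, Function.update_of_ne (hp.ne (by omega) (by omega) (by omega)), Function.update_self]
    have hge : ∀ i, 1 ≤ i → i ≤ r + 1 → w (p i) ≤ w₁ (p i) := fun i hi hi' => by
      rcases Nat.lt_or_ge i (r + 1) with h | h
      · rw [hv i hi (by omega)]
      · have : i = r + 1 := by omega
        subst this
        rw [hr₁]; omega
    obtain ⟨w', e', hR, hz, hge', hw', he'⟩ := ih hp.tail w₁ e₁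
      (by have := hlt 0 (by omega); have := hge 1 le_rfl (by omega); simp only [zero_add] at *; omega)
      (fun i hi => by
        have := hlt (i + 1) (by omega)
        have := hge (i + 1 + 1) (by omega) (by omega)
        rw [hv (i + 1) (by omega) (by omega)]; omega)
    have hz0 : ∀ i, i ≤ r → p 0 ≠ p (i + 1) := fun i hi =>
      hp.ne (by omega) (by omega) (by omega)
    refine ⟨w', e', h1.trans hR, fun i hi => ?_, by omega, fun j hj => ?_, fun j hj => ?_⟩
    · rcases i with _ | i
      · rw [hw' _ hz0, he' _ (fun i hi => hz0 i hi.le), h0₁, he₁, Function.update_self]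
        exact ⟨rfl, rfl⟩
      · exact hz i (by omega)
    · rw [hw' j (fun i hi => hj (i + 1) (by omega)), hw₁, Function.update_of_ne (hj _ le_rfl),
        Function.update_of_ne (hj 0 (by omega))]
    · rw [he' j (fun i hi => hj (i + 1) (by omega)), he₁, Function.update_of_ne (hj 0 (by omega))]

end IsSpineChain

theorem isSpineChain_up {n x r : ℕ} (h : x + r < n) : IsSpineChain n (fun i => x + i) r :=
  ⟨fun i hi => ⟨by omega, by omega, by omega⟩, fun i j _ _ hij => by simpa using hij⟩

theorem isSpineChain_down {n x r : ℕ} (h : x < n) (hr : r ≤ x) :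
    IsSpineChain n (fun i => x - i) r :=
  ⟨fun i hi => ⟨by omega, by omega, by omega⟩, fun i j _ _ hij => by omega⟩

/-- Filling one cell of a profile with a leaf on the same slope. -/
theorem IsProfile.fill {n : ℕ} {h : ℕ → ℕ} (hh : IsProfile n h) {x y : ℕ} (hx : 2 ≤ h x)
    (hy : 2 ≤ h y) (h5 : x ≤ y → h x + y = h y + x) (h6 : y ≤ x → h x + x = h y + y)
    {e : ℕ → ℕ} (he : 0 < e x) :
    SpineReach n (Function.update h y (h y - 1), e) (h, Function.update e x (e x - 1)) := by
  have hxn := hh.lt_of_two_le hx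
  have hyn := hh.lt_of_two_le hy
  rcases eq_or_ne x y with rfl | hxy
  · have := SpineMove.absorb (Function.update h x (h x - 1)) e x hxn
      (by rw [Function.update_self]; omega) he
    rw [Function.update_self, Function.update_idem, Nat.sub_add_cancel (by omega),
      Function.update_eq_self] at this
    exact .single this
  have chain : ∀ (p : ℕ → ℕ) (r : ℕ), IsSpineChain n p (r + 1) → p 0 = x → p (r + 1) = y →
      (∀ i, i ≤ r + 1 → h (p i) = h x + i) →
      SpineReach n (Function.update h y (h y - 1), e) (h, Function.update e x (e x - 1)) := by
    intro p r hp h0 hr hval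
    have hv : ∀ i, i ≤ r → Function.update h y (h y - 1) (p i) = h x + i := fun i hi => by
      rw [← hr, Function.update_of_ne (hp.ne (by omega) (by omega) (by omega)),
        hval i (by omega)]
    have hyr := hval (r + 1) le_rfl
    rw [hr] at hyr
    have := hp.pull (Function.update h y (h y - 1)) e (by rw [hv 0 (by omega)]; omega)
      (by rw [hr, Function.update_self, hv r le_rfl]; omega)
      (fun i hi => by rw [hv i (by omega), hv (i + 1) (by omega)]; omega)
    rw [hr, hv 0 (by omega), h0, Function.update_self, add_zero] at this
    -- The pull has restored `y` and left `x` one short; `2 ≤ h x` keeps `x` positive, so a leaf can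
    -- repair it.
    have hfin := SpineMove.absorb (Function.update (Function.update
      (Function.update h y (h y - 1)) x (h x - 1)) y (h y - 1 + 1)) e x hxn
      (by rw [Function.update_of_ne hxy, Function.update_self]; omega) he
    refine this.trans (.single ?_)
    convert hfin using 2
    funext j
    simp only [Function.update_apply]
    split_ifs <;> first | rfl | omega | (simp_all; done) | (subst_vars; omega)
  rcases Nat.lt_or_gt_of_ne hxy with hlt | hlt
  · have e1 := h5 hlt.le
    refine chain (fun i => x + i) (y - x - 1) (isSpineChain_up (by omega)) rfl
      (by omega) (fun i hi => ?_)
    have a := hh.le_of_le (show x ≤ x + i by omega)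
    have b := hh.le_of_le (show x + i ≤ y by omega)
    omega
  · have e1 := h6 hlt.le
    refine chain (fun i => x - i) (x - y - 1) (isSpineChain_down hxn (by omega)) rfl
      (by omega) (fun i hi => ?_)
    have a := hh.le_of_le (show x - i ≤ x by omega)
    have b := hh.le_of_le (show y ≤ x - i by omega)
    omega

/-- Every profile satisfying the Hall condition can be built. -/
theorem IsProfile.exists_reach {n : ℕ} {h d : ℕ → ℕ} (hh : IsProfile n h)
    (hall : HallCondition n h d) : ∃ e, SpineReach n (fun _ => 1, d) (h, e) := by
  generalize hk : ∑ j ∈ range n, h j = k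
  induction k using Nat.strong_induction_on generalizing h d with
  | _ k ih =>
    by_cases hne : ∃ j, h j ≠ 1
    · obtain ⟨y, x, h1, h2, h3, h4, hdx, h5, h6, hall'⟩ := hall.exists_remove hh hne
      have hm : y ∈ range n := mem_range.2 (hh.lt_of_two_le h4)
      obtain ⟨e, he⟩ := ih _ (by
        rw [sum_update_of_mem hm, sdiff_singleton_eq_erase, ← hk, ← add_sum_erase _ _ hm]
        omega) (hh.remove_weakMax h1 h2 h4) hall' rfl
      have hR := SpineReach.add_leaves he (Pi.single x 1)
      have hd : Function.update d x (d x - 1) + Pi.single x 1 = d := by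
        funext j
        rcases eq_or_ne j x with rfl | hj
        · simp; omega
        · simp [hj]
      simp only [hd] at hR
      exact ⟨_, hR.trans (hh.fill h3 h4 h5 h6 (by simp))⟩
    · push Not at hne
      have : h = fun _ => 1 := funext hne
      exact ⟨d, by rw [this]⟩

theorem SpineReach.absorb_all {n m : ℕ} (hm : m < n) (w e : ℕ → ℕ) (hw : 0 < w m) :
    SpineReach n (w, e) (Function.update w m (w m + e m), Function.update e m 0) := by
  generalize hk : e m = k
  induction k generalizing w e with
  | zero => rw [add_zero, Function.update_eq_self, ← hk, Function.update_eq_self]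
  | succ k ih =>
    refine .head (.absorb w e m hm hw (by omega)) ?_
    have := ih (Function.update w m (w m + 1)) (Function.update e m (e m - 1)) (by simp)
      (by rw [Function.update_self]; omega)
    rw [Function.update_self, Function.update_idem, Function.update_idem, add_assoc,
      add_comm 1 k] at this
    exact this

/-- A pyramid can be collected in its top. -/
theorem exists_collect {n m : ℕ} (hm : m < n) (w e : ℕ → ℕ) (hl : ∀ i, i < m → w i = i + 1)
    (hmw : m < w m) (hr : ∀ j, m < j → j < n → w j = n - j) (hmr : n - 1 - m < w m + m) :
    ∃ w' e', SpineReach n (w, e) (w', e') ∧ (∀ j, j < n → j ≠ m → w' j = 0) ∧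
      ∀ j, j < n → e' j = 0 := by
  obtain ⟨w₁, e₁, hR₁, hz₁, hm₁, hw₁, -⟩ := (isSpineChain_up (n := n) (x := 0) (r := m)
    (by omega)).drain w e
    (by
      rcases Nat.eq_zero_or_pos m with h | h
      · subst h; exact hmw
      · rw [hl _ (by omega)]; omega)
    (fun i hi => by
      simp only [zero_add]
      rw [hl i hi]
      rcases Nat.lt_or_ge (i + 1) m with h | h
      · rw [hl _ h]; omega
      · have : i + 1 = m := by omega
        rw [this]; omega)
  simp only [zero_add] at hz₁ hm₁ hw₁
  have hr₁ : ∀ j, m < j → j < n → w₁ j = n - j := fun j hj hj' => by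
    rw [hw₁ j (fun i hi => by omega), hr j hj hj']
  obtain ⟨w₂, e₂, hR₂, hz₂, hm₂, hw₂, he₂⟩ := (isSpineChain_down (n := n) (x := n - 1)
    (r := n - 1 - m) (by omega) (by omega)).drain w₁ e₁
    (by
      rcases Nat.eq_zero_or_pos (n - 1 - m) with h | h
      · rw [show n - 1 - 0 = m by omega]; omega
      · rw [hr₁ _ (by omega) (by omega)]; omega)
    (fun i hi => by
      rw [hr₁ _ (by omega) (by omega)]
      rcases Nat.lt_or_ge (i + 1) (n - 1 - m) with h | h
      · rw [hr₁ _ (by omega) (by omega)]; omega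
      · rw [show n - 1 - (i + 1) = m by omega]; omega)
  simp only [show n - 1 - (n - 1 - m) = m by omega] at hm₂
  have hzero : ∀ j, j < n → j ≠ m → w₂ j = 0 ∧ e₂ j = 0 := fun j hj hjm => by
    rcases Nat.lt_or_gt_of_ne hjm with h | h
    · rw [hw₂ j (fun i hi => by omega), he₂ j (fun i hi => by omega)]
      exact hz₁ j h
    · have := hz₂ (n - 1 - j) (by omega)
      rwa [show n - 1 - (n - 1 - j) = j by omega] at this
  refine ⟨_, _, (hR₁.trans hR₂).trans (SpineReach.absorb_all hm w₂ e₂ (by omega)),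
    fun j hj hjm => ?_, fun j hj => ?_⟩
  · rw [Function.update_of_ne hjm]; exact (hzero j hj hjm).1
  · rw [Function.update_apply]
    split_ifs with h
    · rfl
    · exact (hzero j hj h).2

/-- The pyramid on `0, …, n - 1`. -/
def pyramid (n j : ℕ) : ℕ := if j < n then min (j + 1) (n - j) else 1

theorem isProfile_pyramid (n : ℕ) : IsProfile n (pyramid n) := by
  refine ⟨fun j => ?_, ?_, fun j hj => ?_, fun j => ?_, fun j => ?_⟩ <;> unfold pyramid <;>
    split_ifs <;> omega

theorem exists_collect_of_hall {n : ℕ} (hn : 0 < n) {d : ℕ → ℕ}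
    (hall : HallCondition n (pyramid n) d) (h2 : n = 2 → 0 < d 0) :
    ∃ m w e, m < n ∧ SpineReach n (fun _ => 1, d) (w, e) ∧ (∀ j, j < n → j ≠ m → w j = 0) ∧
      ∀ j, j < n → e j = 0 := by
  by_cases hn2 : n = 2
  · have hR := SpineMove.absorb (n := n) (fun _ => 1) d 0 hn one_pos (h2 hn2)
    obtain ⟨w, e, h⟩ := exists_collect hn (Function.update (fun _ => 1) 0 (1 + 1))
      (Function.update d 0 (d 0 - 1)) (by simp) (by simp)
      (fun j hj hj' => by rw [Function.update_of_ne (by omega)]; omega)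
      (by rw [Function.update_self]; omega)
    exact ⟨0, w, e, hn, .head hR h.1, h.2⟩
  · obtain ⟨e₀, h₀⟩ := (isProfile_pyramid n).exists_reach hall
    obtain ⟨w, e, h⟩ := exists_collect (n := n) (m := (n - 1) / 2) (by omega) (pyramid n) e₀
      (fun i hi => by unfold pyramid; split_ifs <;> omega)
      (by unfold pyramid; split_ifs <;> omega)
      (fun i hi hi' => by unfold pyramid; split_ifs; omega)
      (by unfold pyramid; split_ifs <;> omega)
    exact ⟨_, w, e, by omega, h₀.trans h.1, h.2⟩

/-! ### From the spine to the caterpillar -/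

section Tree

variable {V : Type*} [Fintype V] {T : SimpleGraph V} [DecidableRel T.Adj]

theorem IsLeafVertex.eq_of_adj {u a b : V} (hu : IsLeafVertex T u) (ha : T.Adj u a)
    (hb : T.Adj u b) : a = b :=
  (SimpleGraph.degree_eq_one_iff_existsUnique_adj.1 hu).unique ha hb

theorem IsLeafVertex.exists_adj {u : V} (hu : IsLeafVertex T u) : ∃ a, T.Adj u a :=
  (SimpleGraph.degree_eq_one_iff_existsUnique_adj.1 hu).exists

theorem eq_or_eq_of_adj_leaves (hT : T.Connected) {a b : V} (ha : IsLeafVertex T a)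
    (hb : IsLeafVertex T b) (hab : T.Adj a b) (x : V) : x = a ∨ x = b := by
  have h := (SimpleGraph.reachable_iff_reflTransGen a x).1 (hT.preconnected a x)
  induction h with
  | refl => exact .inl rfl
  | tail _ hxy ih =>
    rcases ih with rfl | rfl
    · exact .inr (ha.eq_of_adj hxy hab)
    · exact .inl (hb.eq_of_adj hxy hab.symm)

namespace IsSpine

variable {n : ℕ} {v : Fin n → V}

theorem not_leaf (hv : IsSpine T v) (j : Fin n) : ¬ IsLeafVertex T (v j) := by
  have : v j ∈ Set.range v := ⟨j, rfl⟩
  rw [hv.range_eq] at this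
  exact this

theorem exists_eq (hv : IsSpine T v) {x : V} (hx : ¬ IsLeafVertex T x) : ∃ j, v j = x := by
  have : x ∈ Set.range v := by rw [hv.range_eq]; exact hx
  exact this

theorem exists_adj_of_leaf (hv : IsSpine T v) (hT : T.Connected) (hn : 0 < n) {u : V}
    (hu : IsLeafVertex T u) : ∃ j, T.Adj u (v j) := by
  obtain ⟨a, ha⟩ := hu.exists_adj
  by_cases hl : IsLeafVertex T a
  · rcases eq_or_eq_of_adj_leaves hT hu hl ha (v ⟨0, hn⟩) with h | h
    · exact absurd (h ▸ hu) (hv.not_leaf _)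
    · exact absurd (h ▸ hl) (hv.not_leaf _)
  · obtain ⟨j, rfl⟩ := hv.exists_eq hl
    exact ⟨j, ha⟩

theorem adj_iff (hv : IsSpine T v) (hT : T.IsAcyclic) {i j : Fin n} :
    T.Adj (v i) (v j) ↔ (i : ℕ) + 1 = j ∨ (j : ℕ) + 1 = i := by
  have key : ∀ i j : Fin n, (i : ℕ) < j → T.Adj (v i) (v j) → (i : ℕ) + 1 = j := by
    intro i j hij hadj
    by_contra hne
    -- A chord between non-consecutive spine vertices would be a bridge, yet the spine itself still
    -- joins its ends.
    have hb := SimpleGraph.isAcyclic_iff_forall_adj_isBridge.1 hT hadj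
    rw [SimpleGraph.isBridge_iff] at hb
    apply hb
    have : ∀ k (hk : (i : ℕ) + k ≤ j),
        (T \ SimpleGraph.fromEdgeSet {s(v i, v j)}).Reachable (v i) (v ⟨i + k, by omega⟩) := by
      intro k
      induction k with
      | zero => exact fun _ => .refl _
      | succ k ih =>
        intro hk
        refine (ih (by omega)).trans (SimpleGraph.Adj.reachable ?_)
        rw [SimpleGraph.sdiff_adj]
        refine ⟨hv.adj _ _ (by simp [add_assoc]), fun hc => ?_⟩
        rw [SimpleGraph.fromEdgeSet_adj] at hc
        have h1 := hc.1
        simp only [Set.mem_singleton_iff, Sym2.eq_iff, hv.injective.eq_iff, Fin.ext_iff] at h1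
        omega
    have h := this (j - i) (by omega)
    have e : (⟨i + (j - i), by omega⟩ : Fin n) = j := Fin.ext (by simp; omega)
    rw [e] at h
    exact h
  refine ⟨fun h => ?_, fun h => ?_⟩
  · rcases lt_trichotomy (i : ℕ) j with hc | hc | hc
    · exact .inl (key i j hc h)
    · exact absurd (Fin.ext hc ▸ rfl) h.ne
    · exact .inr (key j i hc h.symm)
  · rcases h with h | h
    · exact hv.adj i j h
    · exact (hv.adj j i h).symm

/-- An end of the spine has just one spine neighbour; without a leaf neighbour its degree would be
one. -/
theorem leafDegree_pos_of_end (hv : IsSpine T v) (hT : T.IsTree) (hn : 2 ≤ n) (j : Fin n)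
    (hj : (j : ℕ) = 0 ∨ (j : ℕ) + 1 = n) : 0 < leafDegree T (v j) := by
  rw [leafDegree, card_pos]
  by_contra hne
  rw [not_nonempty_iff_eq_empty, filter_eq_empty_iff] at hne
  obtain ⟨i, hi⟩ : ∃ i : Fin n, (j : ℕ) = 0 ∧ (i : ℕ) = 1 ∨ (j : ℕ) + 1 = n ∧ (i : ℕ) + 1 = j := by
    rcases hj with hj | hj
    · exact ⟨⟨1, by omega⟩, .inl ⟨hj, rfl⟩⟩
    · exact ⟨⟨n - 2, by omega⟩, .inr ⟨hj, by simp; omega⟩⟩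
  refine hv.not_leaf j (SimpleGraph.degree_eq_one_iff_existsUnique_adj.2 ⟨v i,
    (hv.adj_iff hT.isAcyclic).2 (by omega), fun y hy => ?_⟩)
  obtain ⟨k, rfl⟩ := hv.exists_eq (hne ((T.mem_neighborFinset _ _).2 hy))
  have := (hv.adj_iff hT.isAcyclic).1 hy
  exact congrArg v (Fin.ext (by omega))

/-- A weight function on the caterpillar in which every leaf keeps or has given its unit is
described by a state of the game on the spine. -/
structure Represents (T : SimpleGraph V) [DecidableRel T.Adj] {n : ℕ} (v : Fin n → V)
    (W : V → ℕ) (s : (ℕ → ℕ) × (ℕ → ℕ)) : Prop where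
  spine : ∀ j : Fin n, W (v j) = s.1 j
  leaf : ∀ j : Fin n,
    #{u ∈ T.neighborFinset (v j) | IsLeafVertex T u ∧ 0 < W u} = s.2 j
  le_one : ∀ u, IsLeafVertex T u → W u ≤ 1

theorem represents_start (d : ℕ → ℕ) (hd : ∀ j : Fin n, d j = leafDegree T (v j)) :
    Represents T v (fun _ => 1) (fun _ => 1, d) :=
  ⟨fun _ => rfl, fun j => by simp [hd, leafDegree], fun _ _ => le_rfl⟩

variable [DecidableEq V]

theorem Represents.step (hv : IsSpine T v) {W : V → ℕ} {s t : (ℕ → ℕ) × (ℕ → ℕ)}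
    (h : Represents T v W s) (hst : SpineMove n s t) :
    ∃ W', UnitAcqMove T W W' ∧ Represents T v W' t := by
  cases hst with
  | absorb w e j hj hw he =>
    have hc := h.leaf ⟨j, hj⟩
    simp only at hc
    obtain ⟨u, hu⟩ : ({u ∈ T.neighborFinset (v ⟨j, hj⟩) | IsLeafVertex T u ∧ 0 < W u}).Nonempty :=
      card_pos.1 (by omega)
    obtain ⟨hadj, hl, hW⟩ : T.Adj (v ⟨j, hj⟩) u ∧ IsLeafVertex T u ∧ 0 < W u := by
      simpa using hu
    have hW1 : W u = 1 := by have := h.le_one u hl; omega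
    have hs := h.spine ⟨j, hj⟩
    simp only at hs
    refine ⟨_, ⟨u, v ⟨j, hj⟩, hadj.symm, hW, by omega, rfl⟩, fun i => ?_, fun i => ?_, fun x hx => ?_⟩
    · have hne : v i ≠ u := fun hc => hv.not_leaf i (hc ▸ hl)
      simp only [Function.update_apply, hv.injective.eq_iff, hne, if_false, Fin.ext_iff, hs]
      split_ifs
      · rfl
      · exact h.spine i
    · by_cases hij : i = ⟨j, hj⟩
      · subst hij
        simp only [Function.update_self]
        rw [← hc, ← card_erase_of_mem hu]
        congr 1
        ext x
        simp only [mem_filter, mem_erase, SimpleGraph.mem_neighborFinset, Function.update_apply]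
        have : IsLeafVertex T x → x ≠ v ⟨j, hj⟩ := fun hx hc => hv.not_leaf _ (hc ▸ hx)
        split_ifs with h1 h2
        · tauto
        · subst h2; simp [hW1]
        · tauto
      · have hij' : (i : ℕ) ≠ j := fun hc => hij (Fin.ext hc)
        simp only [Function.update_of_ne hij']
        refine Eq.trans ?_ (h.leaf i)
        congr 1
        ext x
        simp only [mem_filter, SimpleGraph.mem_neighborFinset]
        refine and_congr_right fun hx => and_congr_right fun hx' => ?_
        rw [Function.update_of_ne, Function.update_of_ne]
        · rintro rfl
          exact hij (hv.injective (hl.eq_of_adj hx.symm hadj.symm))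
        · rintro rfl
          exact hv.not_leaf _ hx'
    · rw [Function.update_of_ne (fun hc => hv.not_leaf _ (hc ▸ hx)), Function.update_apply]
      split_ifs
      · omega
      · exact h.le_one x hx
  | pass w e i j hij hw hle =>
    have hi := h.spine ⟨i, hij.1⟩
    have hj := h.spine ⟨j, hij.2.1⟩
    simp only at hi hj
    refine ⟨_, ⟨v ⟨i, hij.1⟩, v ⟨j, hij.2.1⟩, ?_, by omega, by omega, rfl⟩, fun k => ?_, fun k => ?_,
      fun x hx => ?_⟩
    · rcases hij.2.2 with h1 | h1
      · exact hv.adj _ _ h1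
      · exact (hv.adj _ _ h1).symm
    · simp only [Function.update_apply, hv.injective.eq_iff, Fin.ext_iff, hi, hj]
      rw [h.spine k]
    · rw [← h.leaf k]
      congr 1
      ext x
      simp only [mem_filter, SimpleGraph.mem_neighborFinset]
      refine and_congr_right fun hx => and_congr_right fun hx' => ?_
      rw [Function.update_of_ne, Function.update_of_ne] <;>
      · rintro rfl
        exact hv.not_leaf _ hx'
    · rw [Function.update_of_ne, Function.update_of_ne]
      · exact h.le_one x hx
      all_goals
        rintro rfl
        exact hv.not_leaf _ hx

theorem Represents.reach (hv : IsSpine T v) {s t : (ℕ → ℕ) × (ℕ → ℕ)} (hst : SpineReach n s t)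
    {W : V → ℕ} (hW : UnitAcqReachable T W) (h : Represents T v W s) :
    ∃ W', UnitAcqReachable T W' ∧ Represents T v W' t := by
  induction hst with
  | refl => exact ⟨W, hW, h⟩
  | tail _ hm ih =>
    obtain ⟨W', hW', h'⟩ := ih
    obtain ⟨W'', hm', h''⟩ := h'.step hv hm
    exact ⟨W'', hW'.tail hm', h''⟩

end IsSpine

variable [DecidableEq V]

theorem UnitAcqMove.exists_pos {V : Type*} [DecidableEq V] {T : SimpleGraph V} {W W' : V → ℕ} (h : UnitAcqMove T W W') : ∃ x, 0 < W' x := by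
  obtain ⟨u, v, -, -, -, rfl⟩ := h
  exact ⟨v, by simp⟩

/-- No reachable configuration is empty, since the receiver of a move ends with positive weight;
hence `1` is a lower bound. -/
theorem unitAcqNumber_eq_one_iff {V : Type*} [Fintype V] [DecidableEq V] {T : SimpleGraph V}
    [Nonempty V] : unitAcqNumber T = 1 ↔
    ∃ W z, UnitAcqReachable T W ∧ ∀ x, 0 < W x ↔ x = z := by
  have hpos : ∀ W, UnitAcqReachable T W → 0 < #{x | 0 < W x} := by
    intro W hW
    rw [card_pos]
    rcases Relation.ReflTransGen.cases_tail hW with rfl | ⟨W', -, hm⟩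
    · exact ⟨Classical.arbitrary V, by simp⟩
    · obtain ⟨x, hx⟩ := hm.exists_pos
      exact ⟨x, by simpa using hx⟩
  have hiff : ∀ W : V → ℕ, #{x | 0 < W x} = 1 ↔ ∃ z, ∀ x, 0 < W x ↔ x = z := fun W => by
    rw [card_eq_one]
    simp [Finset.ext_iff]
  constructor
  · intro h
    have hmem := Nat.sInf_mem (Nat.nonempty_of_sInf_eq_succ h)
    obtain ⟨W, hW, hc⟩ := hmem
    obtain ⟨z, hz⟩ := (hiff W).1 (hc.trans h)
    exact ⟨W, z, hW, hz⟩
  · rintro ⟨W, z, hW, hz⟩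
    refine le_antisymm (Nat.sInf_le ⟨W, hW, (hiff W).2 ⟨z, hz⟩⟩) ?_
    refine le_csInf ⟨_, W, hW, rfl⟩ ?_
    rintro m ⟨W', hW', rfl⟩
    exact hpos W' hW'

theorem unitAcqNumber_eq_one_of_all_leaves (hT : T.Connected) (hl : ∀ x, IsLeafVertex T x) :
    unitAcqNumber T = 1 := by
  have := hT.nonempty
  obtain ⟨a⟩ := hT.nonempty
  obtain ⟨b, hab⟩ := (hl a).exists_adj
  refine unitAcqNumber_eq_one_iff.2 ⟨_, b, .single ⟨a, b, hab, one_pos, le_rfl, rfl⟩, fun x => ?_⟩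
  rcases eq_or_eq_of_adj_leaves hT (hl a) (hl b) hab x with rfl | rfl
  · simp [hab.ne]
  · simp

theorem unitAcqNumber_eq_one_of_hall (hT : T.IsTree) {n : ℕ} {v : Fin n → V} (hv : IsSpine T v)
    (hn : 0 < n) {d : ℕ → ℕ} (hd : ∀ j : Fin n, d j = leafDegree T (v j))
    (hall : HallCondition n (pyramid n) d) : unitAcqNumber T = 1 := by
  have := hT.connected.nonempty
  obtain ⟨m, w, e, hm, hR, hw, he⟩ := exists_collect_of_hall hn hall (fun h2 => by
    have := hv.leafDegree_pos_of_end hT h2.ge ⟨0, hn⟩ (.inl rfl)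
    rwa [← hd] at this)
  obtain ⟨W, hW, hr⟩ := IsSpine.Represents.reach hv hR .refl (IsSpine.represents_start d hd)
  have hsupp : ∀ x, 0 < W x → x = v ⟨m, hm⟩ := by
    intro x hx
    by_cases hl : IsLeafVertex T x
    · obtain ⟨j, hj⟩ := hv.exists_adj_of_leaf hT.connected hn hl
      have h1 := hr.leaf j
      simp only [he j j.2] at h1
      rw [card_eq_zero, filter_eq_empty_iff] at h1
      exact absurd ⟨hl, hx⟩ (h1 ((T.mem_neighborFinset _ _).2 hj.symm))
    · obtain ⟨j, rfl⟩ := hv.exists_eq hl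
      rw [hr.spine j] at hx
      by_contra hne
      have := hw j j.2 (fun hc => hne (congrArg v (Fin.ext hc)))
      simp only at hx
      omega
  obtain ⟨x, hx⟩ : ∃ x, 0 < W x := by
    rcases Relation.ReflTransGen.cases_tail hW with h | ⟨W', -, hm⟩
    · exact ⟨v ⟨m, hm⟩, by rw [h]; exact one_pos⟩
    · exact hm.exists_pos
  refine unitAcqNumber_eq_one_iff.2 ⟨W, _, hW, fun y => ⟨hsupp y, ?_⟩⟩
  rintro rfl
  exact hsupp x hx ▸ hx

end Tree

/-! ### The numbers `ℓ(s)` and Hall's condition for the pyramid -/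

theorem pyramidSize_eq (s : ℕ) : pyramidSize s = (s + 2) / 2 * ((s + 1) / 2) := by
  unfold pyramidSize
  congr 1
  · rcases Nat.even_or_odd' s with ⟨k, rfl | rfl⟩
    · rw [show (2 * k + 2) / 2 = k + 1 by omega, Nat.ceil_eq_iff (by omega)]
      push_cast
      constructor <;> linarith
    · rw [show (2 * k + 1 + 2) / 2 = k + 1 by omega, Nat.ceil_eq_iff (by omega)]
      push_cast
      constructor <;> linarith
  · have := Nat.floor_div_ofNat ((s : ℚ) + 1) 2
    rw [this]
    congr 1
    exact_mod_cast Nat.floor_natCast (R := ℚ) (s + 1)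

theorem sum_min_eq_pyramidSize (s : ℕ) :
    ∑ i ∈ range s, min (i + 1) (s - i) = pyramidSize s := by
  rw [pyramidSize_eq]
  induction s using Nat.twoStepInduction with
  | zero => simp
  | one => simp
  | more s ih _ =>
    rw [sum_range_succ, sum_range_succ']
    have : ∀ i ∈ range s, min (i + 1 + 1) (s + 2 - (i + 1)) = min (i + 1) (s - i) + 1 :=
      fun i hi => by have := mem_range.1 hi; omega
    rw [sum_congr rfl this, sum_add_distrib, ih, sum_const, card_range, smul_eq_mul, mul_one,
      show (s + 2 + 2) / 2 = (s + 2) / 2 + 1 by omega,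
      show (s + 2 + 1) / 2 = (s + 1) / 2 + 1 by omega]
    have h1 : (s + 2) / 2 + (s + 1) / 2 = s + 1 := by omega
    have h2 : min (0 + 1) (s + 2 - 0) = 1 := by omega
    have h3 : min (s + 1 + 1) (s + 2 - (s + 1)) = 1 := by omega
    rw [h2, h3]
    linear_combination h1.symm

theorem sum_Ico_min_eq_pyramidSize {l r : ℕ} :
    ∑ y ∈ Ico l r, min (y + 1 - l) (r - y) = pyramidSize (r - l) := by
  rw [sum_Ico_eq_sum_range, ← sum_min_eq_pyramidSize]
  exact sum_congr rfl fun i _ => by omega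

theorem hallCondition_pyramid {n : ℕ} {d : ℕ → ℕ}
    (hd : ∀ i s, 1 ≤ i → 1 ≤ s → i + s < n → pyramidSize s ≤ ∑ j ∈ Ico i (i + s), d j) :
    HallCondition n (pyramid n) d := by
  intro l r _
  -- The cells above `y` number `min y (n - 1 - y)` and so stay within `1, …, n - 2`; only the
  -- internal part of the interval counts.
  set l' := max l 1 with hl'
  set r' := min r (n - 1) with hr'
  have h1 : cellCount n (pyramid n) l r ≤ ∑ y ∈ range n, min (y + 1 - l') (r' - y) :=
    sum_le_sum fun y hy => by
      have := mem_range.1 hy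
      rw [pyramid, if_pos this]; omega
  have h2 : ∑ y ∈ range n, min (y + 1 - l') (r' - y) ≤ ∑ y ∈ Ico l' r', min (y + 1 - l') (r' - y) := by
    refine sum_le_sum_of_ne_zero fun y _ h => ?_
    rw [mem_Ico]; omega
  rw [sum_Ico_min_eq_pyramidSize] at h2
  rcases Nat.lt_or_ge l' r' with h | h
  · have h3 := hd l' (r' - l') (by omega) (by omega) (by omega)
    rw [Nat.add_sub_cancel' h.le] at h3
    have h4 : ∑ j ∈ Ico l' r', d j ≤ ∑ j ∈ Ico l r, d j :=
      sum_le_sum_of_subset (Ico_subset_Ico (by omega) (by omega))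
    omega
  · rw [Nat.sub_eq_zero_of_le h, show pyramidSize 0 = 0 by rw [pyramidSize_eq]] at h2
    omega

theorem sum_filter_fin_eq_sum_Ico {n : ℕ} (f : Fin n → ℕ) {i s : ℕ} (h : i + s ≤ n) :
    ∑ j ∈ univ.filter (fun j : Fin n => i ≤ (j : ℕ) ∧ (j : ℕ) < i + s), f j =
      ∑ j ∈ Ico i (i + s), if hj : j < n then f ⟨j, hj⟩ else 0 := by
  rw [sum_filter]
  have : ∀ j : Fin n, (if i ≤ (j : ℕ) ∧ (j : ℕ) < i + s then f j else 0) =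
      (fun j : ℕ => if j ∈ Ico i (i + s) then (if hj : j < n then f ⟨j, hj⟩ else 0) else 0) j :=
    fun j => by simp
  rw [sum_congr rfl fun j _ => this j, Fin.sum_univ_eq_sum_range
    (fun j : ℕ => if j ∈ Ico i (i + s) then (if hj : j < n then f ⟨j, hj⟩ else 0) else 0),
    ← sum_filter]
  refine sum_congr ?_ fun _ _ => rfl
  ext j
  simp only [mem_filter, mem_range, mem_Ico]
  omega

/-! ### The blocking obstruction -/

/-- An interval whose two ends carry more weight than the profile `h` while the vertices strictly
between them, even with all the `β` unused leaves, cannot fill the profile. -/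
def Blocked (k : ℕ) (h A : ℕ → ℕ) (β : ℕ) : Prop :=
  ∃ x y, x < y ∧ y ≤ k ∧ h x < A x ∧ h y < A y ∧
    ∑ j ∈ Ioo x y, min (A j) (h j) + β < ∑ j ∈ Ioo x y, h j

namespace Blocked

variable {k : ℕ} {h A A' : ℕ → ℕ} {β β' : ℕ}

theorem absorb (hb : Blocked k h A β) {q : ℕ}
    (hA : ∀ j, j ≤ k → A' j = A j + if j = q then 1 else 0) (hβ : β' + 1 ≤ β) :
    Blocked k h A' β' := by
  obtain ⟨x, y, hxy, hyk, hx, hy, hs⟩ := hb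
  refine ⟨x, y, hxy, hyk, by rw [hA x (by omega)]; omega, by rw [hA y hyk]; omega, ?_⟩
  have : ∑ j ∈ Ioo x y, min (A' j) (h j) ≤
      ∑ j ∈ Ioo x y, (min (A j) (h j) + if j = q then 1 else 0) :=
    sum_le_sum fun j hj => by
      have := mem_Ioo.1 hj
      rw [hA j (by omega)]; split_ifs <;> omega
  rw [sum_add_distrib, sum_ite_eq'] at this
  split_ifs at this <;> omega

/-- Neither end can be `p`, since the ends lie above the profile; losing weight elsewhere never
helps to fill it. -/
theorem lose (hb : Blocked k h A β) {p : ℕ} (hp : A p ≤ h p)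
    (hA : ∀ j, j ≤ k → A' j + (if j = p then 1 else 0) = A j) (hβ : β' ≤ β) :
    Blocked k h A' β' := by
  obtain ⟨x, y, hxy, hyk, hx, hy, hs⟩ := hb
  have hxp : x ≠ p := by rintro rfl; omega
  have hyp : y ≠ p := by rintro rfl; omega
  have h1 := hA x (by omega)
  have h2 := hA y hyk
  rw [if_neg hxp] at h1
  rw [if_neg hyp] at h2
  refine ⟨x, y, hxy, hyk, by omega, by omega, ?_⟩
  have : ∑ j ∈ Ioo x y, min (A' j) (h j) ≤ ∑ j ∈ Ioo x y, min (A j) (h j) :=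
    sum_le_sum fun j hj => by
      have := mem_Ioo.1 hj
      rw [← hA j (by omega)]; omega
  omega

theorem congr (hb : Blocked k h A β) (hA : ∀ j, j ≤ k → A' j = A j) (hβ : β' ≤ β) :
    Blocked k h A' β' := by
  obtain ⟨x, y, hxy, hyk, hx, hy, hs⟩ := hb
  refine ⟨x, y, hxy, hyk, by rwa [hA x (by omega)], by rwa [hA y hyk], ?_⟩
  rw [sum_congr rfl fun j hj => by rw [hA j (by have := mem_Ioo.1 hj; omega)]]
  omega

/-- A unit passes between neighbouring positions. -/
theorem transfer (hb : Blocked k h A β) {p q : ℕ} (hp : p ≤ k) (hq : q ≤ k)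
    (hpq : p + 1 = q ∨ q + 1 = p) (hc : A q < h q → A p ≤ h p)
    (hA : ∀ j, j ≤ k → A' j + (if j = p then 1 else 0) = A j + if j = q then 1 else 0)
    (hβ : β' ≤ β) : Blocked k h A' β' := by
  obtain ⟨x, y, hxy, hyk, hx, hy, hs⟩ := hb
  have hAp := hA p hp
  have hAq := hA q hq
  rw [if_pos rfl, if_neg (by omega)] at hAp
  rw [if_neg (by omega), if_pos rfl] at hAq
  have hAo : ∀ j, j ≤ k → j ≠ p → j ≠ q → A' j = A j := fun j hj h1 h2 => by
    have := hA j hj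
    rw [if_neg h1, if_neg h2] at this
    exact this
  -- If the left end gives away its only excess unit, `hc` says that `q` was not deficient, so `q`
  -- now lies above the profile and becomes the new end. Moving inwards discards a full position;
  -- moving outwards makes `p`, now exactly full, an interior one.
  by_cases hpx : p = x ∧ A p = h p + 1
  · obtain ⟨rfl, hpx⟩ := hpx
    rcases hpq with rfl | rfl
    · rcases eq_or_ne (p + 1) y with rfl | hne
      · rw [show Ioo p (p + 1) = ∅ by ext j; simp] at hs
        simp at hs
      · refine ⟨p + 1, y, by omega, hyk, by omega, by rw [hAo y hyk (by omega) hne.symm]; exact hy, ?_⟩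
        have e : Ioo p y = insert (p + 1) (Ioo (p + 1) y) := by
          ext j; simp only [mem_Ioo, mem_insert]; omega
        rw [e, sum_insert (by simp), sum_insert (by simp)] at hs
        rw [sum_congr rfl fun j hj => by
          have := mem_Ioo.1 hj
          rw [hAo j (by omega) (by omega) (by omega)]]
        omega
    · refine ⟨q, y, by omega, hyk, by omega, by rw [hAo y hyk (by omega) (by omega)]; exact hy, ?_⟩
      have e : Ioo q y = insert (q + 1) (Ioo (q + 1) y) := by
        ext j; simp only [mem_Ioo, mem_insert]; omega
      rw [e, sum_insert (by simp), sum_insert (by simp)]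
      rw [sum_congr rfl fun j hj => by
        have := mem_Ioo.1 hj
        rw [hAo j (by omega) (by omega) (by omega)]]
      omega
  by_cases hpy : p = y ∧ A p = h p + 1
  · obtain ⟨rfl, hpy⟩ := hpy
    rcases hpq with rfl | rfl
    · refine ⟨x, p + 1, by omega, hq, by rw [hAo x (by omega) (by omega) (by omega)]; exact hx,
        by omega, ?_⟩
      have e : Ioo x (p + 1) = insert p (Ioo x p) := by
        ext j; simp only [mem_Ioo, mem_insert]; omega
      rw [e, sum_insert (by simp), sum_insert (by simp)]
      rw [sum_congr rfl fun j hj => by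
        have := mem_Ioo.1 hj
        rw [hAo j (by omega) (by omega) (by omega)]]
      omega
    · rcases eq_or_ne x q with rfl | hne
      · rw [show Ioo x (x + 1) = ∅ by ext j; simp] at hs
        simp at hs
      · refine ⟨x, q, by omega, hq, by rw [hAo x (by omega) (by omega) hne]; exact hx, by omega, ?_⟩
        have e : Ioo x (q + 1) = insert q (Ioo x q) := by
          ext j; simp only [mem_Ioo, mem_insert]; omega
        rw [e, sum_insert (by simp), sum_insert (by simp)] at hs
        rw [sum_congr rfl fun j hj => by
          have := mem_Ioo.1 hj
          rw [hAo j (by omega) (by omega) (by omega)]]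
        omega
  have hkeep : ∀ z, z ≤ k → h z < A z → ¬ (p = z ∧ A p = h p + 1) → h z < A' z := by
    intro z hz hlt hn
    have := hA z hz
    by_cases hzp : z = p
    · subst hzp
      have : A z ≠ h z + 1 := fun hc => hn ⟨rfl, hc⟩
      omega
    · rw [if_neg hzp] at this
      omega
  refine ⟨x, y, hxy, hyk, hkeep x (by omega) hx hpx, hkeep y hyk hy hpy, ?_⟩
  suffices ∑ j ∈ Ioo x y, min (A' j) (h j) ≤ ∑ j ∈ Ioo x y, min (A j) (h j) by omega
  -- Only a deficient interior `q` could gain. Then `hc` puts `p` at or below the profile, so `p` is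
  -- no end but interior, and it loses a unit that was counted.
  by_cases hdef : q ∈ Ioo x y ∧ A q < h q
  · obtain ⟨hqm, hdef⟩ := hdef
    have hple := hc hdef
    have hpm : p ∈ Ioo x y := by
      have hpx' : p ≠ x := by rintro rfl; omega
      have hpy' : p ≠ y := by rintro rfl; omega
      have := mem_Ioo.1 hqm
      exact mem_Ioo.2 (by omega)
    have hle : ∑ j ∈ Ioo x y, (min (A' j) (h j) + if j = p then 1 else 0) ≤
        ∑ j ∈ Ioo x y, (min (A j) (h j) + if j = q then 1 else 0) := by
      refine sum_le_sum fun j hj => ?_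
      have hj' := mem_Ioo.1 hj
      have := hA j (by omega)
      by_cases hjp : j = p
      · subst hjp; omega
      · rw [if_neg hjp] at this ⊢
        omega
    rw [sum_add_distrib, sum_add_distrib, sum_ite_eq', sum_ite_eq', if_pos hpm, if_pos hqm] at hle
    omega
  · refine sum_le_sum fun j hj => ?_
    have hj' := mem_Ioo.1 hj
    have := hA j (by omega)
    by_cases hjq : j = q
    · subst hjq
      have : h j ≤ A j := by by_contra hcon; exact hdef ⟨hj, by omega⟩
      omega
    · rw [if_neg hjq] at this
      omega

end Blocked

/-! ### Invariance of the obstruction on the caterpillar -/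

section Necessity

theorem sum_move_add {V : Type*} [DecidableEq V] {W W' : V → ℕ} {u v : V}
    (huv : u ≠ v) (hu : 0 < W u)
    (hW' : W' = Function.update (Function.update W u (W u - 1)) v (W v + 1)) (S : Finset V) :
    ∑ x ∈ S, W' x + (if u ∈ S then 1 else 0) = ∑ x ∈ S, W x + if v ∈ S then 1 else 0 := by
  rw [← sum_ite_eq' S u (fun _ => 1), ← sum_ite_eq' S v (fun _ => 1), ← sum_add_distrib,
    ← sum_add_distrib]
  refine sum_congr rfl fun x _ => ?_
  simp only [hW', Function.update_apply]
  split_ifs with h1 h2 h3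
  · exact absurd (h2.symm.trans h1) huv
  · rw [h1]; rfl
  · rw [h3]; omega
  · rfl

variable {V : Type*} [Fintype V] {T : SimpleGraph V} [DecidableRel T.Adj]

theorem IsSpine.exists_index {n : ℕ} {v : Fin n → V} (hv : IsSpine T v) :
    ∃ ρ : V → ℕ, (∀ j, ρ (v j) = j) ∧ ∀ u j, IsLeafVertex T u → T.Adj u (v j) → ρ u = j := by
  classical
  refine ⟨fun x => if h : ∃ j, v j = x then (h.choose : ℕ)
    else if h : ∃ j, T.Adj x (v j) then (h.choose : ℕ) else 0, fun j => ?_, fun u j hu hj => ?_⟩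
  · have h : ∃ i, v i = v j := ⟨j, rfl⟩
    simp only [dif_pos h]
    exact congrArg _ (hv.injective h.choose_spec)
  · have h1 : ¬ ∃ i, v i = u := by
      rintro ⟨i, rfl⟩
      exact hv.not_leaf i hu
    have h2 : ∃ i, T.Adj u (v i) := ⟨j, hj⟩
    simp only [dif_neg h1, dif_pos h2]
    exact congrArg _ (hv.injective (hu.eq_of_adj h2.choose_spec hj))

/-- With respect to the interval `i, …, i + s - 1` of the spine: class `0` is everything to the
left of the vertex `i - 1` together with its leaves, class `s + 3` is everything to the right of the
vertex `i + s` together with its leaves, the classes in between are the single spine vertices from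
`i - 1` to `i + s`, and class `s + 4` consists of the leaves at the interval. -/
def spineClass (T : SimpleGraph V) [DecidableRel T.Adj] (ρ : V → ℕ) (i s : ℕ) (x : V) : ℕ :=
  if ρ x + 1 < i then 0 else if i + s < ρ x then s + 3 else
    if IsLeafVertex T x then
      if ρ x + 1 = i then 0 else if ρ x = i + s then s + 3 else s + 4
    else ρ x + 2 - i

/-- The total weight of a class. -/
def classWeight (T : SimpleGraph V) [DecidableRel T.Adj] (ρ : V → ℕ) (i s : ℕ) (W : V → ℕ)
    (p : ℕ) : ℕ := ∑ x with spineClass T ρ i s x = p, W x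

/-- The number of leaves at the interval that still carry weight. -/
def aliveLeaves (T : SimpleGraph V) [DecidableRel T.Adj] (ρ : V → ℕ) (i s : ℕ) (W : V → ℕ) : ℕ :=
  #{x | spineClass T ρ i s x = s + 4 ∧ 0 < W x}

/-- The profile `1, 2, …, 2, 1` on the classes `1, …, s + 2`. -/
def classHeight (s p : ℕ) : ℕ := min p (s + 3 - p)

variable {n : ℕ} {v : Fin n → V} {ρ : V → ℕ} {i s : ℕ}

theorem IsSpine.spineClass_inj (hv : IsSpine T v) (hρ : ∀ j, ρ (v j) = j) {x y : V}
    (hxy : spineClass T ρ i s x = spineClass T ρ i s y) (h1 : 1 ≤ spineClass T ρ i s x)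
    (h2 : spineClass T ρ i s x ≤ s + 2) : x = y := by
  have key : ∀ x, 1 ≤ spineClass T ρ i s x → spineClass T ρ i s x ≤ s + 2 →
      ¬ IsLeafVertex T x ∧ spineClass T ρ i s x = ρ x + 2 - i ∧ i ≤ ρ x + 1 := by
    intro x h1 h2
    by_cases c1 : ρ x + 1 < i
    · rw [spineClass, if_pos c1] at h1; omega
    by_cases c2 : i + s < ρ x
    · rw [spineClass, if_neg c1, if_pos c2] at h2; omega
    by_cases c3 : IsLeafVertex T x
    · rw [spineClass, if_neg c1, if_neg c2, if_pos c3] at h1 h2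
      split_ifs at h1 h2 <;> omega
    · exact ⟨c3, by rw [spineClass, if_neg c1, if_neg c2, if_neg c3], by omega⟩
  obtain ⟨a1, a2, a3⟩ := key x h1 h2
  obtain ⟨b1, b2, b3⟩ := key y (by omega) (by omega)
  obtain ⟨j, rfl⟩ := hv.exists_eq a1
  obtain ⟨k, rfl⟩ := hv.exists_eq b1
  rw [hρ] at a2 a3 b2 b3
  exact congrArg v (Fin.ext (by omega))

theorem IsSpine.classWeight_eq (hv : IsSpine T v) (hρ : ∀ j, ρ (v j) = j) (W : V → ℕ) {x : V}
    (h1 : 1 ≤ spineClass T ρ i s x) (h2 : spineClass T ρ i s x ≤ s + 2) :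
    classWeight T ρ i s W (spineClass T ρ i s x) = W x := by
  rw [classWeight, sum_eq_single x]
  · intro y hy hne
    exact absurd (hv.spineClass_inj hρ ((mem_filter.1 hy).2).symm h1 h2).symm hne
  · simp

/-- How the classes of adjacent vertices are related. -/
theorem IsSpine.spineClass_of_adj (hv : IsSpine T v) (hT : T.IsTree) (hn : 0 < n)
    (hρ : ∀ j, ρ (v j) = j) (hρl : ∀ u j, IsLeafVertex T u → T.Adj u (v j) → ρ u = j) {a b : V}
    (hab : T.Adj a b) :
    spineClass T ρ i s a = spineClass T ρ i s b ∨
    (spineClass T ρ i s a ≤ s + 3 ∧ spineClass T ρ i s b ≤ s + 3 ∧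
      (spineClass T ρ i s a + 1 = spineClass T ρ i s b ∨
        spineClass T ρ i s b + 1 = spineClass T ρ i s a)) ∨
    (IsLeafVertex T a ∧ spineClass T ρ i s a = s + 4 ∧ 1 ≤ spineClass T ρ i s b ∧
      spineClass T ρ i s b ≤ s + 2) ∨
    (IsLeafVertex T b ∧ spineClass T ρ i s b = s + 4 ∧ 1 ≤ spineClass T ρ i s a ∧
      spineClass T ρ i s a ≤ s + 2) := by
  by_cases ha : IsLeafVertex T a
  · obtain ⟨j, hj⟩ := hv.exists_adj_of_leaf hT.connected hn ha
    obtain rfl := ha.eq_of_adj hj hab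
    have h1 := hρl a j ha hj
    have h2 := hρ j
    have h3 := hv.not_leaf j
    unfold spineClass
    simp only [ha, h1, h2, h3, if_true, if_false, true_and, false_and]
    split_ifs <;> omega
  · obtain ⟨k, rfl⟩ := hv.exists_eq ha
    by_cases hb : IsLeafVertex T b
    · have h1 := hρl b k hb hab.symm
      have h2 := hρ k
      unfold spineClass
      simp only [ha, hb, h1, h2, if_true, if_false, true_and, false_and]
      split_ifs <;> omega
    · obtain ⟨j, rfl⟩ := hv.exists_eq hb
      have h := (hv.adj_iff hT.isAcyclic).1 hab
      have h1 := hρ k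
      have h2 := hρ j
      unfold spineClass
      simp only [ha, hb, h1, h2, if_false, false_and]
      split_ifs <;> omega

/-- Removing the bottom row of `s + 2` units from the pyramid on `s + 2` positions leaves the one on
`s` positions. -/
theorem sum_classHeight (s : ℕ) :
    ∑ j ∈ Ioo 0 (s + 3), classHeight s j = pyramidSize s + (s + 2) := by
  have h1 : ∑ j ∈ Ioo 0 (s + 3), classHeight s j = ∑ y ∈ Ico 1 (s + 3), min (y + 1 - 1) (s + 3 - y) :=
    sum_congr (by ext j; simp only [mem_Ioo, mem_Ico]; omega) fun j _ => by
      rw [classHeight, Nat.add_sub_cancel]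
  rw [h1, sum_Ico_min_eq_pyramidSize, pyramidSize_eq, pyramidSize_eq,
    show (s + 3 - 1 + 2) / 2 = (s + 2) / 2 + 1 by omega,
    show (s + 3 - 1 + 1) / 2 = (s + 1) / 2 + 1 by omega]
  have h2 : (s + 2) / 2 + (s + 1) / 2 = s + 1 := by omega
  linear_combination h2

/-- The outer classes contain a leaf at each end of the spine, so they exceed height `0`. Between
them the single vertices fill just the bottom row, and the leaves are too few for the remaining
`ℓ(s)` units. -/
theorem IsSpine.blocked_start (hv : IsSpine T v) (hT : T.IsTree) (hi : 1 ≤ i) (his : i + s < n)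
    (hρ : ∀ j, ρ (v j) = j) (hρl : ∀ u j, IsLeafVertex T u → T.Adj u (v j) → ρ u = j)
    (hlt : ∑ j ∈ univ.filter (fun j : Fin n => i ≤ (j : ℕ) ∧ (j : ℕ) < i + s), leafDegree T (v j)
      < pyramidSize s) :
    Blocked (s + 3) (classHeight s) (classWeight T ρ i s fun _ => 1)
      (aliveLeaves T ρ i s fun _ => 1) := by
  classical
  have hend : ∀ j : Fin n, (j : ℕ) = 0 ∨ (j : ℕ) + 1 = n →
      ∃ u, IsLeafVertex T u ∧ ρ u = j := fun j hj => by
    obtain ⟨u, hu⟩ := card_pos.1 (hv.leafDegree_pos_of_end hT (by omega) j hj)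
    rw [mem_filter, SimpleGraph.mem_neighborFinset] at hu
    exact ⟨u, hu.2, hρl u j hu.2 hu.1.symm⟩
  have hpos : ∀ u, 0 < classWeight T ρ i s (fun _ => 1) (spineClass T ρ i s u) := fun u =>
    sum_pos (fun _ _ => one_pos) ⟨u, by simp⟩
  refine ⟨0, s + 3, by omega, le_rfl, ?_, ?_, ?_⟩
  · obtain ⟨u, hu, hj⟩ := hend ⟨0, by omega⟩ (.inl rfl)
    have : spineClass T ρ i s u = 0 := by
      simp only at hj
      rw [spineClass, hj, if_pos hu]
      split_ifs <;> omega
    have h := hpos u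
    rw [this] at h
    simpa [classHeight] using h
  · obtain ⟨u, hu, hj⟩ := hend ⟨n - 1, by omega⟩ (.inr (by simp only; omega))
    have : spineClass T ρ i s u = s + 3 := by
      simp only at hj
      rw [spineClass, hj, if_pos hu]
      split_ifs <;> omega
    have h := hpos u
    rw [this] at h
    simpa [classHeight] using h
  · have h1 : ∑ j ∈ Ioo 0 (s + 3), min (classWeight T ρ i s (fun _ => 1) j) (classHeight s j) ≤
        s + 2 := by
      have : ∀ j ∈ Ioo 0 (s + 3),
          min (classWeight T ρ i s (fun _ => 1) j) (classHeight s j) ≤ 1 := fun j hj => by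
        refine (min_le_left _ _).trans ?_
        rw [classWeight, sum_const, smul_eq_mul, mul_one, card_le_one]
        intro x hx y hy
        rw [mem_filter] at hx hy
        have := mem_Ioo.1 hj
        exact hv.spineClass_inj hρ (hx.2.trans hy.2.symm) (by omega) (by omega)
      simpa using sum_le_card_nsmul _ _ _ this
    have h2 : aliveLeaves T ρ i s (fun _ => 1) ≤
        ∑ j ∈ univ.filter (fun j : Fin n => i ≤ (j : ℕ) ∧ (j : ℕ) < i + s),
          leafDegree T (v j) := by
      refine le_trans (card_le_card fun x hx => ?_) card_biUnion_le
      rw [mem_filter] at hx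
      have hx1 := hx.2.1
      have hx2 : IsLeafVertex T x := by
        by_contra hc
        rw [spineClass, if_neg hc] at hx1
        split_ifs at hx1 <;> omega
      obtain ⟨j, hj⟩ := hv.exists_adj_of_leaf hT.connected (by omega) hx2
      have h3 := hρl x j hx2 hj
      rw [spineClass, if_pos hx2] at hx1
      refine mem_biUnion.2 ⟨j, ?_, ?_⟩
      · rw [mem_filter]
        refine ⟨mem_univ _, ?_⟩
        split_ifs at hx1 <;> omega
      · rw [mem_filter, SimpleGraph.mem_neighborFinset]
        exact ⟨hj.symm, hx2⟩
    rw [sum_classHeight]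
    omega

/-- A leaf has weight more than one only if its neighbour has none left. -/
def LeafInvariant (T : SimpleGraph V) [DecidableRel T.Adj] (W : V → ℕ) : Prop :=
  ∀ u a, IsLeafVertex T u → T.Adj u a → W u ≤ 1 ∨ W a = 0

variable [DecidableEq V]

theorem UnitAcqMove.pos_of_pos {V : Type*} [DecidableEq V] {T : SimpleGraph V} {W W' : V → ℕ}
    (h : UnitAcqMove T W W') {x : V} (hx : 0 < W' x) : 0 < W x := by
  obtain ⟨u, v, -, hu, huv, rfl⟩ := h
  by_contra h0
  have hxv : x ≠ v := by rintro rfl; omega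
  have hxu : x ≠ u := by rintro rfl; omega
  rw [Function.update_of_ne hxv, Function.update_of_ne hxu] at hx
  exact h0 hx

/-- A leaf of weight at most one receives only from a neighbour of weight one, which is thereby
emptied, and an empty vertex never receives again. -/
theorem LeafInvariant.step {W W' : V → ℕ} (h : LeafInvariant T W) (hm : UnitAcqMove T W W') :
    LeafInvariant T W' := by
  intro x a hx ha
  have hzero : W a = 0 → W' a = 0 := fun h0 => by
    by_contra hc
    have := hm.pos_of_pos (Nat.pos_of_ne_zero hc)
    omega
  obtain ⟨u, v, huv, hu, hle, rfl⟩ := hm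
  rcases h x a hx ha with h1 | h1
  · by_cases hxv : x = v
    · subst hxv
      obtain rfl := hx.eq_of_adj huv.symm ha
      right
      rw [Function.update_of_ne huv.ne, Function.update_self]
      omega
    · left
      rw [Function.update_of_ne hxv, Function.update_apply]
      split_ifs with hxu
      · subst hxu; omega
      · exact h1
  · exact .inr (hzero h1)

theorem IsSpine.blocked_step (hv : IsSpine T v) (hT : T.IsTree) (hn : 0 < n)
    (hρ : ∀ j, ρ (v j) = j) (hρl : ∀ u j, IsLeafVertex T u → T.Adj u (v j) → ρ u = j)
    {W W' : V → ℕ} (hL : LeafInvariant T W)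
    (hb : Blocked (s + 3) (classHeight s) (classWeight T ρ i s W) (aliveLeaves T ρ i s W))
    (hm : UnitAcqMove T W W') :
    Blocked (s + 3) (classHeight s) (classWeight T ρ i s W') (aliveLeaves T ρ i s W') := by
  have hβ : aliveLeaves T ρ i s W' ≤ aliveLeaves T ρ i s W :=
    card_le_card fun x hx => by
      simp only [mem_filter, mem_univ, true_and] at hx ⊢
      exact ⟨hx.1, hm.pos_of_pos hx.2⟩
  have hm' := hm
  obtain ⟨a, b, hab, ha, hle, hW'⟩ := hm'
  have hA : ∀ j, classWeight T ρ i s W' j + (if j = spineClass T ρ i s a then 1 else 0) =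
      classWeight T ρ i s W j + if j = spineClass T ρ i s b then 1 else 0 := fun j => by
    have := sum_move_add hab.ne ha hW' {x | spineClass T ρ i s x = j}
    simpa only [classWeight, mem_filter, mem_univ, true_and, eq_comm (a := j)] using this
  rcases hv.spineClass_of_adj (s := s) hT hn hρ hρl hab with h | ⟨h1, h2, h3⟩ | ⟨h1, h2, h3, h4⟩ |
    ⟨h1, h2, h3, h4⟩
  · refine hb.congr (fun j _ => ?_) hβ
    have := hA j
    rw [h] at this
    omega
  -- A deficient receiver has positive height, so its class is a single vertex. The giver weighs at
  -- most as much, hence at most `h q - 1 ≤ h p`; an outer class cannot be the giver, for its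
  -- receiver would be empty.
  · refine hb.transfer h1 h2 h3 (fun hlt => ?_) (fun j _ => hA j) hβ
    unfold classHeight at *
    have e1 := hv.classWeight_eq (i := i) (s := s) hρ W (x := b) (by omega) (by omega)
    by_cases hp : 1 ≤ spineClass T ρ i s a ∧ spineClass T ρ i s a ≤ s + 2
    · have e2 := hv.classWeight_eq (i := i) (s := s) hρ W hp.1 hp.2
      omega
    · omega
  · have ha1 : W a = 1 := by
      have := hL a b h1 hab
      omega
    refine hb.absorb (q := spineClass T ρ i s b) (fun j hj => ?_) ?_
    · have := hA j
      rwa [if_neg (by omega), add_zero] at this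
    · have hmem : a ∈ ({x | spineClass T ρ i s x = s + 4 ∧ 0 < W x} : Finset V) := by
        simp [h2, ha]
      rw [aliveLeaves, aliveLeaves, ← card_erase_add_one hmem]
      refine Nat.add_le_add_right (card_le_card fun x hx => ?_) 1
      simp only [mem_filter, mem_univ, true_and, mem_erase] at hx ⊢
      refine ⟨?_, hx.1, hm.pos_of_pos hx.2⟩
      rintro rfl
      rw [hW', Function.update_of_ne hab.ne, Function.update_self] at hx
      omega
  -- A spine vertex can give to a leaf only when its weight is `1`, which is never above its height.
  · have hb1 : W a = 1 := by
      have := hL b a h1 hab.symm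
      omega
    refine hb.lose (p := spineClass T ρ i s a) ?_ (fun j hj => ?_) hβ
    · rw [hv.classWeight_eq hρ W h3 h4, hb1, classHeight]
      omega
    · have := hA j
      rwa [if_neg (show j ≠ spineClass T ρ i s b by omega), add_zero] at this

theorem IsSpine.pyramidSize_le (hv : IsSpine T v) (hT : T.IsTree) (hi : 1 ≤ i) (his : i + s < n)
    {W : V → ℕ} {z : V} (hW : UnitAcqReachable T W) (hz : ∀ x, 0 < W x ↔ x = z) :
    pyramidSize s ≤
      ∑ j ∈ univ.filter (fun j : Fin n => i ≤ (j : ℕ) ∧ (j : ℕ) < i + s), leafDegree T (v j) := by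
  by_contra hlt
  obtain ⟨ρ, hρ, hρl⟩ := hv.exists_index
  have hinv : ∀ W, UnitAcqReachable T W → LeafInvariant T W ∧
      Blocked (s + 3) (classHeight s) (classWeight T ρ i s W) (aliveLeaves T ρ i s W) := by
    intro W hW
    induction hW with
    | refl => exact ⟨fun _ _ _ _ => .inl le_rfl,
        hv.blocked_start hT hi his hρ hρl (not_le.1 hlt)⟩
    | tail _ hm ih =>
      exact ⟨ih.1.step hm, hv.blocked_step hT (by omega) hρ hρl ih.1 ih.2 hm⟩
  obtain ⟨x, y, hxy, -, hx, hy, -⟩ := (hinv W hW).2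
  have hex : ∀ p, classHeight s p < classWeight T ρ i s W p → spineClass T ρ i s z = p := by
    intro p hp
    obtain ⟨a, ha, ha'⟩ := exists_ne_zero_of_sum_ne_zero (show classWeight T ρ i s W p ≠ 0 by omega)
    rw [← (hz a).1 (Nat.pos_of_ne_zero ha')]
    exact (mem_filter.1 ha).2
  -- A single occupied vertex lies in one class only, whereas the obstruction has two distinct
  -- nonempty classes.
  have := hex x hx
  have := hex y hy
  omega

end Necessity

theorem mainTheorem1 {V : Type*} [Fintype V] [DecidableEq V] (T : SimpleGraph V)
    [DecidableRel T.Adj] (hT : IsCaterpillar T) (n : ℕ) (v : Fin n → V) (hv : IsSpine T v) :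
    unitAcqNumber T = 1 ↔
      ∀ i s : ℕ, 1 ≤ i → 1 ≤ s → i + s < n →
        pyramidSize s ≤
          ∑ j ∈ Finset.univ.filter (fun j : Fin n => i ≤ (j : ℕ) ∧ (j : ℕ) < i + s),
            leafDegree T (v j) := by
  have htree := hT.1
  have := htree.connected.nonempty
  constructor
  · intro h i s hi _ his
    obtain ⟨W, z, hW, hz⟩ := unitAcqNumber_eq_one_iff.1 h
    exact hv.pyramidSize_le htree hi his hW hz
  · intro h
    rcases Nat.eq_zero_or_pos n with rfl | hn
    · refine unitAcqNumber_eq_one_of_all_leaves htree.connected fun x => ?_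
      by_contra hx
      exact (hv.exists_eq hx).choose.elim0
    · refine unitAcqNumber_eq_one_of_hall htree hv hn
        (d := fun j => if hj : j < n then leafDegree T (v ⟨j, hj⟩) else 0)
        (fun j => dif_pos j.2) (hallCondition_pyramid fun i s hi hs his => ?_)
      rw [← sum_filter_fin_eq_sum_Ico (fun j => leafDegree T (v j)) his.le]
      exact h i s hi hs his
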